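/- **Conventions.** For an infinite cardinal $\kappa$, "$\kappa$-small" means of cardinality $<\kappa$, and $[\Omega]^{<\kappa}$ is the poset of all $\kappa$-small subsets of $\Omega$. Directed colimits are colimits of diagrams indexed by nonempty directed posets; "small" means indexed by sets. A *projection* in a category is a canonical projection from a nonempty finite product to one of its factors (in particular, every isomorphism is a projection). An *extended projection* is the limit morphism of a natural transformation, all of whose components are projections, between two diagrams indexed by the same small directed poset and having colimits. A poset-indexed diagram $(C_i)_{i\in I}$ is *continuous* if $C_p=\varinjlim_{q\in D}C_q$ whenever $D\subseteq I$ is nonempty and directed with least upper bound $p$. An object $C$ is *weakly $\lambda$-presented* if, for every set $\Omega$ and every continuous $[\Omega]^{<\lambda}$-indexed diagram $(D_Y)_Y$ with colimit $D$, every morphism $C\to D$ factors through some limiting morphism $D_Y\to D$. If a subcategory $\mathcal S^{\Rightarrow}$ of $\mathcal S$ is given, its morphisms are called *double arrows* and written $\Rightarrow$; a double arrow between diagrams is a natural transformation all of whose components are double arrows. **Larders.** Let $\lambda,\mu$ be infinite cardinals. A *$(\lambda,\mu)$-larder at $B$* is an octuple $\Lambda=(\mathcal A,\mathcal B,\mathcal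 S,\mathcal A^\dagger,\mathcal B^\dagger,\mathcal S^{\Rightarrow},\Phi,\Psi)$ with categories $\mathcal A,\mathcal B,\mathcal S$, an object $B$ of $\mathcal B$, full subcategories $\mathcal A^\dagger\subseteq\mathcal A$ and $\mathcal B^\dagger\subseteq\mathcal B$, a subcategory $\mathcal S^{\Rightarrow}\subseteq\mathcal S$, and functors $\Phi\colon\mathcal A\to\mathcal S$, $\Psi\colon\mathcal B\to\mathcal S$, such that: $\mathcal A$ has all small directed colimits; any two objects of $\mathcal A$ have a product; $\Phi$ preserves all small directed colimits; $\Phi(f)$ is a double arrow for each extended projection $f$ of $\mathcal A$; $\Psi(B')$ is weakly $\lambda$-presented in $\mathcal S$ for each $B'\in\mathcal B^\dagger$; and for each $A\in\mathcal A^\dagger$, each double arrow $\psi\colon\Psi(B)\Rightarrow\Phi(A)$, each $\mu$-small set $I$, and each family of monomorphisms $\gamma_i\colon C_i\rightarrowtail B$ $(i\in I)$ with $C_i\in\mathcal B^\dagger$, there is a monomorphism $\gamma\colon C\rightarrowtail B$ with $C\in\mathcal B^\dagger$ such that every $\gamma_i$ factors through $\gamma$ and $\psi\circ\Psi(\gamma)$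 is a double arrow. $\Lambda$ is *strong* if every $\mu$-small directed diagram with all its objects in $\mathcal B^\dagger$ has a colimit in $\mathcal B$ whose vertex belongs to $\mathcal B^\dagger$; $\Psi$ preserves all $\mu$-small directed colimits; and, for every $\mu$-small directed colimit $(S,\sigma_i)_{i\in I}=\varinjlim_{i\in I}S_i$ in $\mathcal S$ and every $f\colon S\to T$, if all $f\circ\sigma_i$ are double arrows, then so is $f$. A *projectability witness* for $\varphi\colon\Psi(C)\to S$ is a pair $(a,\varepsilon)$ consisting of an epimorphism $a\colon C\to C'$ of $\mathcal B$ and an isomorphism $\varepsilon\colon\Psi(C')\to S$ with $\varphi=\varepsilon\circ\Psi(a)$, such that for all $f\colon C\to Z$ and $\eta\colon\Psi(C')\to\Psi(Z)$ with $\Psi(f)=\eta\circ\Psi(a)$ there is $g\colon C'\to Z$ with $f=g\circ a$ and $\eta=\Psi(g)$. $\Lambda$ is *projectable* if every double arrow $\Psi(C)\Rightarrow S$, for $C\in\mathcal B$ and $S\in\mathcal S$, has a projectability witness. **Lifters.** For a subset $Y$ of a poset $X$, let $\triangledown Y$ be the set of all minimal upper bounds of $Y$. The poset $X$ is a *pseudo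 join-semilattice* if the set of upper bounds of $\varnothing$ (that is, $X$) and of each $\{x,y\}\subseteq X$ is a finitely generated upper subset; it is *supported* if moreover every finite subset of $X$ is contained in a finite subset $Y$ with $\triangledown Z\subseteq Y$ for all finite $Z\subseteq Y$. Let $P$ be a poset. A *norm-covering* of $P$ is a nonempty pseudo join-semilattice $X$ with an isotone map $\partial\colon X\to P$. A *sharp ideal* of $X$ is an ideal $\boldsymbol x$ of $X$ (nonempty directed lower subset) such that $\{\partial x\mid x\in\boldsymbol x\}$ has a largest element, denoted $\partial\boldsymbol x$; sharp ideals are ordered by containment. For a set $\boldsymbol X$ of sharp ideals, put $\boldsymbol X^{=}=\{\boldsymbol x\in\boldsymbol X\mid\partial\boldsymbol x\text{ not maximal in }P\}$. A *$\lambda$-lifter* of $P$ is a pair $(X,\boldsymbol X)$, with $X$ a norm-covering of $P$ and $\boldsymbol X$ a set of sharp ideals of $X$, such that: $\{\boldsymbol y\in\boldsymbol X\mid\boldsymbol y\subseteq\boldsymbol x\}$ has cardinality $<\operatorname{cf}(\lambda)$ for each $\boldsymbol x\in\boldsymbol X^{=}$; for each map $S\colon\boldsymbol X^{=}\to[X]^{<\lambda}$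 there is an isotone map $\sigma\colon P\to\boldsymbol X$ with $\partial\sigma(p)=p$ for all $p$ and $S(\sigma(a))\cap\sigma(b)\subseteq\sigma(a)$ for all $a<b$ in $P$; and, if $\lambda=\aleph_0$, then $X$ is supported. **Condensates.** A *$P$-scaled Boolean algebra* is a Boolean algebra $U$ with ideals $U^{(p)}$ $(p\in P)$ such that, in the lattice of ideals of $U$, $U=\bigvee_{p}U^{(p)}$ and $U^{(p)}\cap U^{(q)}=\bigvee_{r\geq p,q}U^{(r)}$. For a norm-covering $X$ of $P$, $\mathbf F(X)$ is the Boolean algebra defined by generators $\tilde u$ $(u\in X)$ and relations $\tilde v\leq\tilde u$ for $u\leq v$, $\tilde u\wedge\tilde v=\bigvee\{\tilde w\mid w\in\triangledown\{u,v\}\}$, and $1=\bigvee\{\tilde u\mid u\text{ minimal in }X\}$, with $\mathbf F(X)^{(p)}$ the ideal generated by all $\tilde u$ with $p\leq\partial u$; it is a $P$-scaled Boolean algebra. For a nontrivial $P$-scaled Boolean algebra $U$, let $\Sigma_U$ be the set of all maps $f\colon\operatorname{At}V\to P$, where $V=V_f$ is a finite subalgebra of $U$ and $u\in U^{(f(u))}$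 for each atom $u$ of $V$; put $f\sqsubseteq g$ if $V_f\subseteq V_g$ and $f(u)\leq g(v)$ whenever $v\leq u$; this makes $\Sigma_U$ a directed poset. For a $P$-indexed diagram $\vec A=(A_p,\alpha_p^q)_{p\leq q}$ in $\mathcal A$, the *condensate* is $$U\otimes\vec A=\varinjlim_{f\in\Sigma_U}\ \prod_{u\in\operatorname{At}V_f}A_{f(u)},$$ where, for $f\sqsubseteq g$, the component of the transition morphism at $v\in\operatorname{At}V_g$ is the projection at the unique $u\in\operatorname{At}V_f$ with $v\leq u$, followed by $\alpha_{f(u)}^{g(v)}$. **Condensate Lifting Lemma.** Let $\lambda$ and $\mu$ be infinite cardinals, let $\Lambda=(\mathcal A,\mathcal B,\mathcal S,\mathcal A^\dagger,\mathcal B^\dagger,\mathcal S^{\Rightarrow},\Phi,\Psi)$ be a $(\lambda,\mu)$-larder at an object $B$ of $\mathcal B$, and let $P$ be a poset with a $\lambda$-lifter $(X,\boldsymbol X)$. Let $\vec A=(A_p,\alpha_p^q)_{p\leq q\text{ in }P}$ be a $P$-indexed diagram in $\mathcal A$ such that $A_p\in\mathcal A^\dagger$ for each non-maximal $p\in P$,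 and let $\chi\colon\Psi(B)\Rightarrow\Phi(\mathbf F(X)\otimes\vec A)$ be a double arrow in $\mathcal S$. Then in each of the following cases, 1. $\mu=\aleph_0$ and $\boldsymbol X^{=}$ is lower finite (each of its elements has only finitely many elements of $\boldsymbol X^{=}$ below it); 2. $\mu=\operatorname{cf}(\lambda)$ and $\boldsymbol X^{=}$ is well-founded; 3. $\mu=\operatorname{cf}(\lambda)$ and $\Lambda$ is strong; there are a $P$-indexed diagram $\vec B=(B_p)_{p\in P}$ in $\mathcal B$ and a double arrow $\vec\chi\colon\Psi\vec B\Rightarrow\Phi\vec A$ in $\mathcal S^P$ such that $B_p\in\mathcal B^\dagger$ for each non-maximal $p\in P$ and $B_p=B$ for each maximal $p\in P$. Furthermore, if $\Lambda$ is projectable, then there are a $P$-indexed diagram $\vec B'$ in $\mathcal B$ with a natural equivalence $\Psi\vec B'\cong\Phi\vec A$, and a natural transformation $\vec B\to\vec B'$ all of whose components are epimorphisms. -/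

import Mathlib

open CategoryTheory CategoryTheory.Limits Cardinal

universe w v v₁ v₂ v₃ u u₁ u₂ u₃

namespace CLL

/-! ## Posets -/

section Posets

variable {Q : Type u} [PartialOrder Q]

/-- `▽ Y`: the set of all minimal upper bounds of `Y`. -/
def nabla (Y : Set Q) : Set Q := {a | Minimal (fun b => b ∈ upperBounds Y) a}

variable (Q) in
/-- A poset is a pseudo join-semilattice if the set of common upper bounds of any subset that is
either empty or of the form `{x, y}` is a finitely generated upper subset. -/
def IsPseudoJoinSemilattice : Prop :=
  ∀ Y : Set Q, (Y = ∅ ∨ ∃ x y, Y = {x, y}) →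
    ∃ V : Set Q, V.Finite ∧ upperBounds Y = (upperClosure V : Set Q)

/-- `Y` is `▽`-closed if `▽ Z ⊆ Y` for each finite `Z ⊆ Y`. -/
def NablaClosed (Y : Set Q) : Prop := ∀ Z : Set Q, Z.Finite → Z ⊆ Y → nabla Z ⊆ Y

/-- The `▽`-closure of `Y`: the least `▽`-closed subset containing `Y`. -/
def nablaClosure (Y : Set Q) : Set Q := ⋂₀ {Z | NablaClosed Z ∧ Y ⊆ Z}

variable (Q) in
/-- A poset is supported if it is a pseudo join-semilattice in which the `▽`-closure of any finite
subset is finite. -/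
def IsSupported : Prop :=
  IsPseudoJoinSemilattice Q ∧ ∀ Y : Set Q, Y.Finite → (nablaClosure Y).Finite

theorem upperBounds_subset_of_pjs (hQ : IsPseudoJoinSemilattice Q) {Y : Set Q}
    (hY : Y = ∅ ∨ ∃ x y, Y = {x, y}) {a : Q} (ha : a ∈ upperBounds Y) :
    ∃ b ∈ nabla Y, b ≤ a := by
  obtain ⟨V, hV, hVe⟩ := hQ Y hY
  have ha' : a ∈ (upperClosure V : Set Q) := hVe ▸ ha
  obtain ⟨c, hcV, hca⟩ := ha'
  obtain ⟨b, hbc, hb⟩ := hV.exists_le_minimal hcV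
  refine ⟨b, ⟨?_, ?_⟩, hbc.trans hca⟩
  · have : b ∈ (upperClosure V : Set Q) := ⟨b, hb.1, le_rfl⟩
    exact hVe ▸ this
  · intro d hd hdb
    have hd' : d ∈ (upperClosure V : Set Q) := hVe ▸ hd
    obtain ⟨e, heV, hed⟩ := hd'
    exact (hb.2 heV (hed.trans hdb)).trans hed

theorem nabla_finite (hQ : IsPseudoJoinSemilattice Q) {Y : Set Q}
    (hY : Y = ∅ ∨ ∃ x y, Y = {x, y}) : (nabla Y).Finite := by
  obtain ⟨V, hV, hVe⟩ := hQ Y hY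
  refine hV.subset fun a ha => ?_
  have ha' : a ∈ (upperClosure V : Set Q) := hVe ▸ ha.1
  obtain ⟨c, hcV, hca⟩ := ha'
  have hc : c ∈ upperBounds Y := by
    have : c ∈ (upperClosure V : Set Q) := ⟨c, hcV, le_rfl⟩
    exact hVe ▸ this
  have : a = c := le_antisymm (ha.2 hc hca) hca
  exact this ▸ hcV

end Posets

/-! ## Boolean algebras defined by generators and relations -/

/-- Terms in the language of Boolean algebras over a set `G` of variables. -/
inductive BoolTerm (G : Type u) : Type u
  | var (g : G) : BoolTerm G
  | top : BoolTerm G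
  | bot : BoolTerm G
  | sup (s t : BoolTerm G) : BoolTerm G
  | inf (s t : BoolTerm G) : BoolTerm G
  | compl (s : BoolTerm G) : BoolTerm G

namespace BoolTerm

variable {G : Type u}

/-- The value of a term in a Boolean algebra, for a given assignment of the variables. -/
def eval {B : Type v} [BooleanAlgebra B] (f : G → B) : BoolTerm G → B
  | var g => f g
  | top => ⊤
  | bot => ⊥
  | sup s t => eval f s ⊔ eval f t
  | inf s t => eval f s ⊓ eval f t
  | compl s => (eval f s)ᶜ

/-- The join of a finite list of variables. -/
def listSup (l : List G) : BoolTerm G := l.foldr (fun g t => sup (var g) t) bot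

/-- The congruence on terms generated by the axioms of Boolean algebras and by the relations
`R s t` (each of which means `s = t`). -/
inductive Cong (R : BoolTerm G → BoolTerm G → Prop) : BoolTerm G → BoolTerm G → Prop
  | of {s t} : R s t → Cong R s t
  | refl (s) : Cong R s s
  | symm {s t} : Cong R s t → Cong R t s
  | trans {r s t} : Cong R r s → Cong R s t → Cong R r t
  | sup_congr {s s' t t'} : Cong R s s' → Cong R t t' → Cong R (sup s t) (sup s' t')
  | inf_congr {s s' t t'} : Cong R s s' → Cong R t t' → Cong R (inf s t) (inf s' t')
  | compl_congr {s s'} : Cong R s s' → Cong R (compl s) (compl s')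
  | sup_comm (s t) : Cong R (sup s t) (sup t s)
  | sup_assoc (r s t) : Cong R (sup (sup r s) t) (sup r (sup s t))
  | inf_comm (s t) : Cong R (inf s t) (inf t s)
  | inf_assoc (r s t) : Cong R (inf (inf r s) t) (inf r (inf s t))
  | sup_inf_self (s t) : Cong R (sup s (inf s t)) s
  | inf_sup_self (s t) : Cong R (inf s (sup s t)) s
  | sup_inf_left (r s t) : Cong R (sup r (inf s t)) (inf (sup r s) (sup r t))
  | sup_bot (s) : Cong R (sup s bot) s
  | inf_top (s) : Cong R (inf s top) s
  | inf_compl (s) : Cong R (inf s (compl s)) bot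
  | sup_compl (s) : Cong R (sup s (compl s)) top

/-- The setoid associated with `Cong`. -/
def congSetoid (R : BoolTerm G → BoolTerm G → Prop) : Setoid (BoolTerm G) where
  r := Cong R
  iseqv := ⟨Cong.refl, Cong.symm, Cong.trans⟩

theorem Cong.eval_eq {R : BoolTerm G → BoolTerm G → Prop} {B : Type v} [BooleanAlgebra B]
    (f : G → B) (hf : ∀ s t, R s t → eval f s = eval f t) {s t : BoolTerm G} (h : Cong R s t) :
    eval f s = eval f t := by
  induction h with
  | of h => exact hf _ _ h
  | refl => rfl
  | symm _ ih => exact ih.symm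
  | trans _ _ ih₁ ih₂ => exact ih₁.trans ih₂
  | sup_congr _ _ ih₁ ih₂ => simp only [eval, ih₁, ih₂]
  | inf_congr _ _ ih₁ ih₂ => simp only [eval, ih₁, ih₂]
  | compl_congr _ ih => simp only [eval, ih]
  | sup_comm => simp only [eval]; exact _root_.sup_comm _ _
  | sup_assoc => simp only [eval]; exact _root_.sup_assoc _ _ _
  | inf_comm => simp only [eval]; exact _root_.inf_comm _ _
  | inf_assoc => simp only [eval]; exact _root_.inf_assoc _ _ _
  | sup_inf_self => simp only [eval]; exact _root_.sup_inf_self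
  | inf_sup_self => simp only [eval]; exact _root_.inf_sup_self
  | sup_inf_left => simp only [eval]; exact _root_.sup_inf_left _ _ _
  | sup_bot => simp only [eval]; exact sup_bot_eq _
  | inf_top => simp only [eval]; exact inf_top_eq _
  | inf_compl => simp only [eval]; exact inf_compl_eq_bot
  | sup_compl => simp only [eval]; exact sup_compl_eq_top

end BoolTerm

/-- The Boolean algebra defined by the set `G` of generators and the set `R` of relations. -/
def PresentedBool {G : Type u} (R : BoolTerm G → BoolTerm G → Prop) : Type u :=
  Quotient (BoolTerm.congSetoid R)

namespace PresentedBool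

variable {G : Type u} {R : BoolTerm G → BoolTerm G → Prop}

/-- The element represented by a term. -/
def mk (s : BoolTerm G) : PresentedBool R := Quotient.mk (BoolTerm.congSetoid R) s

/-- The canonical generators. -/
def gen (g : G) : PresentedBool R := mk (.var g)

theorem mk_eq {s t : BoolTerm G} (h : BoolTerm.Cong R s t) :
    (mk s : PresentedBool R) = mk t := Quotient.sound h

instance : Lattice (PresentedBool R) :=
  letI : Max (PresentedBool R) :=
    ⟨Quotient.map₂ BoolTerm.sup fun _ _ h _ _ h' => BoolTerm.Cong.sup_congr h h'⟩
  letI : Min (PresentedBool R) :=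
    ⟨Quotient.map₂ BoolTerm.inf fun _ _ h _ _ h' => BoolTerm.Cong.inf_congr h h'⟩
  Lattice.mk'
    (by rintro ⟨s⟩ ⟨t⟩; exact mk_eq (.sup_comm s t))
    (by rintro ⟨r⟩ ⟨s⟩ ⟨t⟩; exact mk_eq (.sup_assoc r s t))
    (by rintro ⟨s⟩ ⟨t⟩; exact mk_eq (.inf_comm s t))
    (by rintro ⟨r⟩ ⟨s⟩ ⟨t⟩; exact mk_eq (.inf_assoc r s t))
    (by rintro ⟨s⟩ ⟨t⟩; exact mk_eq (.sup_inf_self s t))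
    (by rintro ⟨s⟩ ⟨t⟩; exact mk_eq (.inf_sup_self s t))

instance : BooleanAlgebra (PresentedBool R) where
  le_sup_inf := by
    rintro ⟨r⟩ ⟨s⟩ ⟨t⟩
    exact le_of_eq (mk_eq (.symm (.sup_inf_left r s t)))
  top := mk .top
  bot := mk .bot
  compl := Quotient.map BoolTerm.compl fun _ _ h => BoolTerm.Cong.compl_congr h
  inf_compl_le_bot := by
    rintro ⟨s⟩
    exact le_of_eq (mk_eq (.inf_compl s))
  top_le_sup_compl := by
    rintro ⟨s⟩
    exact le_of_eq (mk_eq (.symm (.sup_compl s)))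
  le_top := by
    rintro ⟨s⟩
    exact inf_eq_left.1 (mk_eq (.inf_top s))
  bot_le := by
    rintro ⟨s⟩
    exact sup_eq_left.1 (mk_eq (.sup_bot s))

/-- The value of an element under an assignment of the generators satisfying the relations. -/
def lift {B : Type v} [BooleanAlgebra B] (f : G → B)
    (hf : ∀ s t, R s t → BoolTerm.eval f s = BoolTerm.eval f t) : PresentedBool R → B :=
  Quotient.lift (BoolTerm.eval f) fun _ _ h => BoolTerm.Cong.eval_eq f hf h

end PresentedBool

/-! ## `P`-scaled Boolean algebras -/

/-- A `P`-scaled Boolean algebra: a Boolean algebra `A` with ideals `A^(p)`, for `p ∈ P`, such that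
`A` is the join of all `A^(p)` and `A^(p) ∩ A^(q)` is the join of all `A^(r)` with `r ≥ p, q`, the
joins being taken in the lattice of ideals of `A`. -/
structure ScaledBool (P : Type w) [PartialOrder P] where
  carrier : Type w
  [str : BooleanAlgebra carrier]
  ideal : P → Order.Ideal carrier
  iSup_ideal : ⨆ p, ideal p = ⊤
  inf_ideal : ∀ p q, ideal p ⊓ ideal q = ⨆ r : {r : P // p ≤ r ∧ q ≤ r}, ideal r

namespace ScaledBool

variable {P : Type w} [PartialOrder P]

instance : CoeSort (ScaledBool P) (Type w) := ⟨ScaledBool.carrier⟩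

instance (A : ScaledBool P) : BooleanAlgebra A := A.str

/-- An element of `Σ_A`: a finite subalgebra `U` of `A` together with a map `f : At U → P` such
that `u ∈ A^(f u)` for each atom `u` of `U`. The finite subalgebra is given by the set of its atoms,
that is, by a finite partition of the unit of `A` into nonzero elements. This represents the compact
`P`-scaled Boolean algebra `A_f` with underlying algebra `U` in which `‖u‖ = {p | p ≤ f u}` for each
atom `u`. -/
@[ext]
structure Chart (A : ScaledBool P) where
  part : Finpartition (⊤ : A)
  val : part.parts → P
  mem : ∀ u : part.parts, u.1 ∈ A.ideal (val u)

namespace Chart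

variable {A : ScaledBool P}

theorem part_unique (f : Chart A) {v : A} (hv : v ≠ ⊥) {u u' : f.part.parts}
    (h : v ≤ u.1) (h' : v ≤ u'.1) : u = u' := by
  by_contra hne
  have hd : Disjoint u.1 u'.1 := f.part.disjoint u.2 u'.2 fun he => hne (Subtype.ext he)
  exact hv (le_bot_iff.1 (hd h h'))

/-- `f ⊑ g` if the subalgebra of `f` is contained in that of `g` (i.e., the partition of `g` refines
that of `f`) and `f u ≤ g v` whenever `v` is an atom of the latter lying below the atom `u` of the
former. -/
instance : PartialOrder (Chart A) where
  le f g := g.part ≤ f.part ∧ ∀ (u : f.part.parts) (v : g.part.parts), v.1 ≤ u.1 → f.val u ≤ g.val v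
  le_refl f := ⟨le_rfl, fun u v h => by
    rw [f.part_unique (f.part.ne_bot v.2) h le_rfl]⟩
  le_trans f g h hfg hgh := ⟨hgh.1.trans hfg.1, fun u x hxu => by
    obtain ⟨v, hv, hxv⟩ := hgh.1 x.2
    obtain ⟨u', hu', hvu'⟩ := hfg.1 hv
    have : u = ⟨u', hu'⟩ := f.part_unique (h.part.ne_bot x.2) hxu (hxv.trans hvu')
    subst this
    exact (hfg.2 _ ⟨v, hv⟩ hvu').trans (hgh.2 ⟨v, hv⟩ x hxv)⟩
  le_antisymm f g hfg hgf := by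
    obtain ⟨π, a, ha⟩ := f
    obtain ⟨ρ, b, hb⟩ := g
    obtain rfl : π = ρ := le_antisymm hgf.1 hfg.1
    congr
    funext u
    exact le_antisymm (hfg.2 u u le_rfl) (hgf.2 u u le_rfl)

theorem exists_parent {f g : Chart A} (h : f ≤ g) (v : g.part.parts) :
    ∃ u : f.part.parts, v.1 ≤ u.1 := by
  obtain ⟨u, hu, hvu⟩ := h.1 v.2
  exact ⟨⟨u, hu⟩, hvu⟩

/-- For `f ⊑ g` and an atom `v` of the subalgebra of `g`, the unique atom of the subalgebra of `f`
above `v`. -/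
noncomputable def parent {f g : Chart A} (h : f ≤ g) (v : g.part.parts) : f.part.parts :=
  (exists_parent h v).choose

theorem le_parent {f g : Chart A} (h : f ≤ g) (v : g.part.parts) : v.1 ≤ (parent h v).1 :=
  (exists_parent h v).choose_spec

theorem val_parent_le {f g : Chart A} (h : f ≤ g) (v : g.part.parts) :
    f.val (parent h v) ≤ g.val v := h.2 _ _ (le_parent h v)

theorem parent_eq {f g : Chart A} (h : f ≤ g) (v : g.part.parts) (u : f.part.parts)
    (hu : v.1 ≤ u.1) : u = parent h v :=
  f.part_unique (g.part.ne_bot v.2) hu (le_parent h v)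

theorem exists_finpartition (I : P → Order.Ideal A) (R : Set P) (u : A)
    (hu : u ∈ ⨆ r : R, I r) :
    ∃ π : Finpartition u, ∀ x ∈ π.parts, ∃ r ∈ R, x ∈ I r := by
  classical
  let J : Order.Ideal A :=
    { carrier := {u | ∃ π : Finpartition u, ∀ x ∈ π.parts, ∃ r ∈ R, x ∈ I r}
      lower' := by
        rintro a b hba ⟨π, hπ⟩
        refine ⟨π.restrict hba, fun x hx => ?_⟩
        simp only [Finpartition.restrict, Finset.mem_erase, Finset.mem_image] at hx
        obtain ⟨-, y, hy, rfl⟩ := hx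
        obtain ⟨r, hr, hyr⟩ := hπ y hy
        exact ⟨r, hr, (I r).lower inf_le_left hyr⟩
      nonempty' := ⟨⊥, Finpartition.empty _, fun x hx => by simp at hx⟩
      directed' := by
        rintro a ⟨π, hπ⟩ b ⟨ρ, hρ⟩
        refine ⟨a ⊔ b, ?_, le_sup_left, le_sup_right⟩
        have hd : Disjoint a (b \ a) := disjoint_sdiff_self_right
        have hab : a ⊔ b \ a = a ⊔ b := sup_sdiff_self_right a b
        let F : ∀ i : Bool, Finpartition (bif i then a else b \ a) := fun i =>
          match i with
          | true => π
          | false => ρ.restrict sdiff_le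
        have hF : (Finset.univ : Finset Bool).SupIndep fun i => bif i then a else b \ a := by
          rw [Finset.supIndep_iff_pairwiseDisjoint]
          rintro (_ | _) - (_ | _) - hij
          · exact absurd rfl hij
          · exact hd.symm
          · exact hd
          · exact absurd rfl hij
        refine ⟨(Finpartition.combine F hF).copy (by simp), fun x hx => ?_⟩
        have hx' : x ∈ Finset.univ.biUnion fun i => (F i).parts := hx
        rw [Finset.mem_biUnion] at hx'
        obtain ⟨i, -, hi⟩ := hx'
        cases i with
        | true => exact hπ x hi
        | false =>
          have hi' : x ∈ (ρ.restrict (sdiff_le : b \ a ≤ b)).parts := hi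
          simp only [Finpartition.restrict, Finset.mem_erase, Finset.mem_image] at hi'
          obtain ⟨-, y, hy, rfl⟩ := hi'
          obtain ⟨r, hr, hyr⟩ := hρ y hy
          exact ⟨r, hr, (I r).lower inf_le_left hyr⟩ }
  have hJ : ⨆ r : R, I r ≤ J := by
    refine iSup_le fun r y hy => ?_
    by_cases h0 : y = ⊥
    · subst h0
      exact ⟨Finpartition.empty _, fun x hx => by simp at hx⟩
    · refine ⟨Finpartition.indiscrete h0, fun x hx => ?_⟩
      have hx' : x = y := by simpa [Finpartition.indiscrete] using hx
      exact hx' ▸ ⟨r, r.2, hy⟩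
  exact hJ hu

instance : Nonempty (Chart A) := by
  classical
  have h : (⊤ : A) ∈ ⨆ r : (Set.univ : Set P), A.ideal r := by
    have h1 : ⨆ r : (Set.univ : Set P), A.ideal r = ⊤ := by
      rw [← A.iSup_ideal]
      exact iSup_subtype.trans (by simp)
    rw [h1]
    exact Set.mem_univ _
  obtain ⟨π, hπ⟩ := exists_finpartition A.ideal _ _ h
  choose r _ hr using hπ
  exact ⟨⟨π, fun u => r u.1 u.2, fun u => hr u.1 u.2⟩⟩

instance : IsDirectedOrder (Chart A) := by
  classical
  refine ⟨fun f g => ?_⟩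
  have key : ∀ u ∈ (f.part ⊓ g.part).parts, ∃ π : Finpartition u, ∀ x ∈ π.parts,
      ∃ r, (∀ a : f.part.parts, x ≤ a.1 → f.val a ≤ r) ∧
        (∀ b : g.part.parts, x ≤ b.1 → g.val b ≤ r) ∧ x ∈ A.ideal r := by
    intro u hu
    obtain ⟨a, ha, hua⟩ := (inf_le_left : f.part ⊓ g.part ≤ f.part) hu
    obtain ⟨b, hb, hub⟩ := (inf_le_right : f.part ⊓ g.part ≤ g.part) hu
    have hmem : u ∈ A.ideal (f.val ⟨a, ha⟩) ⊓ A.ideal (g.val ⟨b, hb⟩) :=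
      ⟨(A.ideal _).lower hua (f.mem ⟨a, ha⟩), (A.ideal _).lower hub (g.mem ⟨b, hb⟩)⟩
    rw [A.inf_ideal] at hmem
    obtain ⟨π, hπ⟩ := exists_finpartition A.ideal
      {r | f.val ⟨a, ha⟩ ≤ r ∧ g.val ⟨b, hb⟩ ≤ r} u hmem
    refine ⟨π, fun x hx => ?_⟩
    obtain ⟨r, hr, hxr⟩ := hπ x hx
    have hxu : x ≤ u := π.le hx
    refine ⟨r, fun a' ha' => ?_, fun b' hb' => ?_, hxr⟩
    · rw [f.part_unique (π.ne_bot hx) ha' (u' := ⟨a, ha⟩) (hxu.trans hua)]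
      exact hr.1
    · rw [g.part_unique (π.ne_bot hx) hb' (u' := ⟨b, hb⟩) (hxu.trans hub)]
      exact hr.2
  choose π hπ using key
  have hbind : ∀ x ∈ ((f.part ⊓ g.part).bind π).parts,
      ∃ r, (∀ a : f.part.parts, x ≤ a.1 → f.val a ≤ r) ∧
        (∀ b : g.part.parts, x ≤ b.1 → g.val b ≤ r) ∧ x ∈ A.ideal r := by
    intro x hx
    obtain ⟨u, hu, hxu⟩ := Finpartition.mem_bind.1 hx
    exact hπ u hu x hxu
  have hle : (f.part ⊓ g.part).bind π ≤ f.part ⊓ g.part := by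
    intro x hx
    obtain ⟨u, hu, hxu⟩ := Finpartition.mem_bind.1 hx
    exact ⟨u, hu, (π u hu).le hxu⟩
  choose r hr₁ hr₂ hr₃ using hbind
  exact ⟨⟨(f.part ⊓ g.part).bind π, fun x => r x.1 x.2, fun x => hr₃ x.1 x.2⟩,
    ⟨hle.trans inf_le_left, fun u x hxu => hr₁ x.1 x.2 u hxu⟩,
    ⟨hle.trans inf_le_right, fun u x hxu => hr₂ x.1 x.2 u hxu⟩⟩

end Chart

end ScaledBool

/-! ## Condensates -/

/-- A category has all small directed colimits. -/
def HasSmallDirectedColimits (C : Type u) [Category.{v} C] : Prop :=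
  ∀ (J : Type w) [PartialOrder J] [IsDirectedOrder J] [Nonempty J], HasColimitsOfShape J C

theorem hasProduct_of_hasBinaryProducts {C : Type u} [Category.{v} C] (h : HasBinaryProducts C)
    {ι : Type w} [Finite ι] [Nonempty ι] (Z : ι → C) : HasProduct Z := by
  have key : ∀ (n : ℕ) (f : Fin (n + 1) → C), HasProduct f := by
    intro n
    induction n with
    | zero =>
      intro f
      have : Subsingleton (Fin (0 + 1)) := inferInstanceAs (Subsingleton (Fin 1))
      exact hasProduct_unique f
    | succ n ih =>
      intro f
      have := ih fun i => f i.succ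
      exact HasLimit.mk ⟨_, extendFanIsLimit f (limit.isLimit _) (limit.isLimit _)⟩
  obtain ⟨n, ⟨e⟩⟩ := Finite.exists_equiv_fin ι
  cases n with
  | zero => exact (e (Classical.arbitrary ι)).elim0
  | succ n =>
    have := key n (Z ∘ e.symm)
    exact hasProduct_of_equiv_of_iso (Z ∘ e.symm) Z e fun i => eqToIso (by simp)

section Condensate

variable {C : Type u} [Category.{v} C] {P : Type w} [PartialOrder P] (A : ScaledBool P)

/-- All the products `A_f ⊗ S = ∏ (S_{f u} : u ∈ At A_f)` exist. -/
def HasTensor (S : P ⥤ C) : Prop :=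
  ∀ f : ScaledBool.Chart A, HasProduct fun u : f.part.parts => S.obj (f.val u)

theorem hasTensor [Nontrivial A] (h : HasBinaryProducts C) (S : P ⥤ C) : HasTensor A S := by
  intro f
  have : Nonempty f.part.parts :=
    (f.part.parts_nonempty (top_ne_bot : (⊤ : A) ≠ ⊥)).to_subtype
  exact hasProduct_of_hasBinaryProducts h _

variable {A}

/-- The morphism `A_f ⊗ S ⟶ A_g ⊗ S` induced by the inclusion `A_f ⊆ A_g`, for `f ⊑ g`: its
component at an atom `v` of `A_g` is the projection at the atom `u` of `A_f` above `v`, followed by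
`S_{f u} ⟶ S_{g v}`. -/
noncomputable def tensorMap {S : P ⥤ C} (hS : HasTensor A S) {f g : ScaledBool.Chart A}
    (h : f ≤ g) :
    haveI := hS f; haveI := hS g
    (∏ᶜ fun u : f.part.parts => S.obj (f.val u)) ⟶ ∏ᶜ fun v : g.part.parts => S.obj (g.val v) :=
  haveI := hS f; haveI := hS g
  Pi.lift fun v => Pi.π (fun u : f.part.parts => S.obj (f.val u)) (f.parent h v) ≫
    S.map (homOfLE (ScaledBool.Chart.val_parent_le h v))

/-- The `Σ_A`-indexed diagram `f ↦ A_f ⊗ S = ∏ (S_{f u} : u ∈ At A_f)`. -/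
noncomputable def tensorDiagram {S : P ⥤ C} (hS : HasTensor A S) : ScaledBool.Chart A ⥤ C where
  obj f := haveI := hS f; ∏ᶜ fun u : f.part.parts => S.obj (f.val u)
  map h := tensorMap hS (leOfHom h)
  map_id f := by
    have := hS f
    refine Pi.hom_ext _ _ fun v => ?_
    have aux : ∀ (u : f.part.parts) (hu : v = u) (hle : f.val u ≤ f.val v),
        Pi.π (fun u : f.part.parts => S.obj (f.val u)) u ≫ S.map (homOfLE hle) =
          Pi.π (fun u : f.part.parts => S.obj (f.val u)) v := by
      rintro u rfl hle
      have : homOfLE hle = 𝟙 _ := rfl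
      rw [this, S.map_id, Category.comp_id]
    simp only [tensorMap, Pi.lift_π, Category.id_comp]
    exact aux _ (ScaledBool.Chart.parent_eq le_rfl v v le_rfl) _
  map_comp {f g k} hfg hgk := by
    have := hS f; have := hS g; have := hS k
    refine Pi.hom_ext _ _ fun v => ?_
    have aux : ∀ (u u' : f.part.parts) (hu : u = u') (hle : f.val u ≤ k.val v)
        (hle' : f.val u' ≤ k.val v),
        Pi.π (fun u : f.part.parts => S.obj (f.val u)) u ≫ S.map (homOfLE hle) =
          Pi.π (fun u : f.part.parts => S.obj (f.val u)) u' ≫ S.map (homOfLE hle') := by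
      rintro u _ rfl hle hle'
      rfl
    simp only [tensorMap, Pi.lift_π, Category.assoc, Pi.lift_π_assoc, ← S.map_comp, homOfLE_comp]
    refine aux _ _ (Eq.symm (ScaledBool.Chart.parent_eq _ v _ ?_)) _ _
    exact (ScaledBool.Chart.le_parent (leOfHom hgk) v).trans
      (ScaledBool.Chart.le_parent (leOfHom hfg) _)

/-- The condensate `A ⊗ S`: the colimit of all `A_f ⊗ S`, for `f ∈ Σ_A`. -/
noncomputable def condensate (hC : HasSmallDirectedColimits.{w} C) (hP : HasBinaryProducts C)
    (A : ScaledBool P) [Nontrivial A] (S : P ⥤ C) : C :=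
  haveI := hC (ScaledBool.Chart A)
  colimit (tensorDiagram (hasTensor A hP S))

end Condensate

/-! ## Norm-coverings and lifters -/

/-- A norm-covering of `P`: a (nonempty) pseudo join-semilattice `X` with an isotone map
`∂ : X → P`. -/
structure NormCovering (P : Type w) [PartialOrder P] where
  carrier : Type w
  [str : PartialOrder carrier]
  [nonempty : Nonempty carrier]
  pjs : IsPseudoJoinSemilattice carrier
  norm : carrier →o P

namespace NormCovering

variable {P : Type w} [PartialOrder P]

instance : CoeSort (NormCovering P) (Type w) := ⟨NormCovering.carrier⟩

variable (X : NormCovering P)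

instance : PartialOrder X := X.str

instance : Nonempty X := X.nonempty

/-- The defining relations of `F(X)`: `ṽ ≤ ũ` if `u ≤ v`; `ũ ∧ ṽ = ⋁ (w̃ : w ∈ u ▽ v)`;
`1 = ⋁ (ũ : u ∈ Min X)`. Finite joins are written through lists enumerating the given set. -/
inductive Rel : BoolTerm X → BoolTerm X → Prop
  | antitone {u v : X} (h : u ≤ v) : Rel (.inf (.var v) (.var u)) (.var v)
  | inf (u v : X) (l : List X) (hl : ∀ x, x ∈ l ↔ x ∈ nabla {u, v}) :
      Rel (.inf (.var u) (.var v)) (BoolTerm.listSup l)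
  | top (l : List X) (hl : ∀ x, x ∈ l ↔ IsMin x) : Rel .top (BoolTerm.listSup l)

/-- The Boolean algebra `F(X)`. -/
abbrev freeBool : Type w := PresentedBool X.Rel

/-- The canonical generators `ũ` of `F(X)`. -/
def gen (u : X) : X.freeBool := PresentedBool.gen u

/-- The ideal `F(X)^(p)` of `F(X)` generated by all `ũ` with `p ≤ ∂ u`. -/
def freeIdeal (p : P) : Order.Ideal X.freeBool :=
  sInf {I | ∀ u : X, p ≤ X.norm u → X.gen u ∈ I}

theorem gen_mem {p : P} {u : X} (h : p ≤ X.norm u) : X.gen u ∈ X.freeIdeal p :=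
  Order.Ideal.mem_sInf.2 fun _ hI => hI u h

theorem freeIdeal_le {p : P} {I : Order.Ideal X.freeBool}
    (h : ∀ u : X, p ≤ X.norm u → X.gen u ∈ I) : X.freeIdeal p ≤ I := sInf_le h

theorem mk_listSup_mem {I : Order.Ideal X.freeBool} (l : List X) (h : ∀ u ∈ l, X.gen u ∈ I) :
    PresentedBool.mk (BoolTerm.listSup l) ∈ I := by
  induction l with
  | nil => exact I.bot_mem
  | cons a l ih =>
    exact Order.Ideal.sup_mem (h a (by simp)) (ih fun u hu => h u (by simp [hu]))

theorem isMin_iff_nabla_empty (u : X) : IsMin u ↔ u ∈ nabla (∅ : Set X) := by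
  simp only [nabla, upperBounds_empty, Set.mem_univ, Set.mem_ofPred_eq]
  exact ⟨fun h => ⟨trivial, fun _ _ hb => h hb⟩, fun h b hb => h.2 trivial hb⟩

theorem iSup_freeIdeal : ⨆ p, X.freeIdeal p = ⊤ := by
  have hfin : {u : X | IsMin u}.Finite := by
    refine (nabla_finite X.pjs (Y := (∅ : Set X)) (Or.inl rfl)).subset fun u hu => ?_
    exact (X.isMin_iff_nabla_empty u).1 hu
  have h1 : (⊤ : X.freeBool) = PresentedBool.mk (BoolTerm.listSup hfin.toFinset.toList) :=
    PresentedBool.mk_eq (.of (.top _ fun x => by simp))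
  rw [← Order.Ideal.top_mem_iff_eq_top, h1]
  refine X.mk_listSup_mem _ fun u _ => ?_
  exact (le_iSup X.freeIdeal (X.norm u)) (X.gen_mem le_rfl)

theorem gen_inf_gen_mem (u v : X) {I : Order.Ideal X.freeBool}
    (h : ∀ x, u ≤ x → v ≤ x → X.gen x ∈ I) : X.gen u ⊓ X.gen v ∈ I := by
  have hfin : (nabla ({u, v} : Set X)).Finite := nabla_finite X.pjs (Or.inr ⟨u, v, rfl⟩)
  have h1 : X.gen u ⊓ X.gen v = PresentedBool.mk (BoolTerm.listSup hfin.toFinset.toList) :=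
    PresentedBool.mk_eq (.of (.inf u v _ fun x => by simp))
  rw [h1]
  refine X.mk_listSup_mem _ fun x hx => ?_
  have hx' : x ∈ nabla ({u, v} : Set X) := by simpa using hx
  exact h x (hx'.1 (by simp)) (hx'.1 (by simp))

theorem gen_anti {u v : X} (h : u ≤ v) : X.gen v ≤ X.gen u :=
  inf_eq_left.1 (PresentedBool.mk_eq (.of (.antitone h)))

theorem freeIdeal_anti {p q : P} (h : p ≤ q) : X.freeIdeal q ≤ X.freeIdeal p :=
  X.freeIdeal_le fun _ hu => X.gen_mem (h.trans hu)

/-- Relative pseudo-complement of ideals with respect to an element: all `a` with `a ⊓ b ∈ I`. -/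
def residual {B : Type u} [BooleanAlgebra B] (I : Order.Ideal B) (b : B) : Order.Ideal B where
  carrier := {a | a ⊓ b ∈ I}
  lower' := fun _ _ hac ha => I.lower (inf_le_inf_right b hac) ha
  nonempty' := ⟨⊥, by simp⟩
  directed' := fun a ha c hc => ⟨a ⊔ c, by
    change (a ⊔ c) ⊓ b ∈ I
    rw [inf_sup_right]
    exact Order.Ideal.sup_mem ha hc, le_sup_left, le_sup_right⟩

theorem inf_freeIdeal (p q : P) :
    X.freeIdeal p ⊓ X.freeIdeal q = ⨆ r : {r : P // p ≤ r ∧ q ≤ r}, X.freeIdeal r := by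
  apply le_antisymm
  · set J := ⨆ r : {r : P // p ≤ r ∧ q ≤ r}, X.freeIdeal r with hJ
    have h1 : ∀ u v : X, p ≤ X.norm u → q ≤ X.norm v → X.gen u ⊓ X.gen v ∈ J := by
      intro u v hu hv
      refine X.gen_inf_gen_mem u v fun x hux hvx => ?_
      exact (le_iSup (fun r : {r : P // p ≤ r ∧ q ≤ r} => X.freeIdeal r)
        ⟨X.norm x, hu.trans (X.norm.monotone hux), hv.trans (X.norm.monotone hvx)⟩)
        (X.gen_mem le_rfl)
    have h2 : ∀ v : X, q ≤ X.norm v → ∀ a ∈ X.freeIdeal p, a ⊓ X.gen v ∈ J := fun v hv a ha =>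
      X.freeIdeal_le (I := residual J (X.gen v)) (fun u hu => h1 u v hu hv) ha
    rintro a ⟨hap, haq⟩
    have h3 : a ∈ residual J a :=
      X.freeIdeal_le (I := residual J a) (fun v hv => by
        change X.gen v ⊓ a ∈ J
        rw [inf_comm]
        exact h2 v hv a hap) haq
    have h4 : a ⊓ a ∈ J := h3
    rwa [inf_idem] at h4
  · exact iSup_le fun r => le_inf (X.freeIdeal_anti r.2.1) (X.freeIdeal_anti r.2.2)

/-- The `P`-scaled Boolean algebra `F(X)`. -/
def scaled : ScaledBool P where
  carrier := X.freeBool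
  ideal := X.freeIdeal
  iSup_ideal := X.iSup_freeIdeal
  inf_ideal := X.inf_freeIdeal

theorem eval_listSup (f : X → Prop) (l : List X) :
    BoolTerm.eval f (BoolTerm.listSup l) = ∃ u ∈ l, f u := by
  induction l with
  | nil => simp [BoolTerm.listSup, BoolTerm.eval]
  | cons a l ih =>
    have : BoolTerm.eval f (BoolTerm.listSup (a :: l)) =
      (f a ∨ BoolTerm.eval f (BoolTerm.listSup l)) := rfl
    rw [this, ih]
    simp

instance : Nontrivial X.scaled := by
  obtain ⟨z⟩ := X.nonempty
  have hrel : ∀ s t, X.Rel s t →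
      BoolTerm.eval (fun u : X => u ≤ z) s = BoolTerm.eval (fun u : X => u ≤ z) t := by
    intro s t h
    cases h with
    | @antitone u v h =>
      change (v ≤ z ∧ u ≤ z) = (v ≤ z)
      exact propext ⟨fun h' => h'.1, fun h' => ⟨h', h.trans h'⟩⟩
    | inf u v l hl =>
      rw [eval_listSup]
      change (u ≤ z ∧ v ≤ z) = _
      apply propext
      constructor
      · rintro ⟨hu, hv⟩
        have hz : z ∈ upperBounds ({u, v} : Set X) := by
          rintro x (rfl | rfl)
          · exact hu
          · exact hv
        obtain ⟨b, hb, hbz⟩ := upperBounds_subset_of_pjs X.pjs (Or.inr ⟨u, v, rfl⟩) hz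
        exact ⟨b, (hl b).2 hb, hbz⟩
      · rintro ⟨b, hb, hbz⟩
        have hb' := (hl b).1 hb
        exact ⟨(hb'.1 (by simp)).trans hbz, (hb'.1 (by simp)).trans hbz⟩
    | top l hl =>
      rw [eval_listSup]
      change True = _
      refine (eq_true ?_).symm
      obtain ⟨b, hb, hbz⟩ := upperBounds_subset_of_pjs X.pjs (Y := (∅ : Set X)) (Or.inl rfl)
        (a := z) (by simp)
      exact ⟨b, (hl b).2 ((X.isMin_iff_nabla_empty b).2 hb), hbz⟩
  refine ⟨⟨(⊤ : X.freeBool), (⊥ : X.freeBool), fun h => ?_⟩⟩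
  have h' := congrArg (PresentedBool.lift _ hrel) h
  have h'' : True = False := h'
  exact h''.mp trivial

/-- Sharp ideals of `X`: the ideals `u` of `X` such that `{∂ x | x ∈ u}` has a largest element. They
are ordered by containment. -/
def SharpIdeal : Type w := {u : Order.Ideal X // ∃ p, IsGreatest (X.norm '' (u : Set X)) p}

instance : PartialOrder X.SharpIdeal := Subtype.partialOrder _

variable {X}

/-- The norm `∂ u` of a sharp ideal `u`: the largest element of `{∂ x | x ∈ u}`. -/
noncomputable def SharpIdeal.norm (u : X.SharpIdeal) : P := u.2.choose

/-- For a set `XX` of sharp ideals, the set `XX^=` of all elements of `XX` of non-maximal norm. -/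
def nonMaximal (XX : Set X.SharpIdeal) : Set X.SharpIdeal := {x ∈ XX | ¬ IsMax x.norm}

/-- `(X, XX)` is a `lam`-lifter of `P`. (In `free`, the values of `S` outside `XX^=` are irrelevant:
if `a < b`, then `σ a` has the non-maximal norm `a`.) -/
structure IsLifter (lam : Cardinal.{w}) (X : NormCovering P) (XX : Set X.SharpIdeal) : Prop where
  lower_small : ∀ x ∈ nonMaximal XX, #{y : X.SharpIdeal // y ∈ XX ∧ y ≤ x} < lam.ord.cof
  free : ∀ S : X.SharpIdeal → Set X, (∀ x ∈ nonMaximal XX, #(S x) < lam) →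
    ∃ σ : P →o X.SharpIdeal, (∀ p, σ p ∈ XX) ∧ (∀ p, (σ p).norm = p) ∧
      ∀ a b, a < b → S (σ a) ∩ ((σ b).1 : Set X) ⊆ ((σ a).1 : Set X)
  supported : lam = ℵ₀ → IsSupported X

end NormCovering

/-! ## Categorical notions -/

section Categories

variable {C : Type u} [Category.{v} C]

/-- A class of morphisms that is the class of morphisms of a (not necessarily wide or full)
subcategory; the objects of the subcategory are those whose identity belongs to the class. -/
structure IsSubcategory (W : MorphismProperty C) : Prop where
  comp_mem : ∀ {X Y Z : C} (f : X ⟶ Y) (g : Y ⟶ Z), W f → W g → W (f ≫ g)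
  id_source : ∀ {X Y : C} (f : X ⟶ Y), W f → W (𝟙 X)
  id_target : ∀ {X Y : C} (f : X ⟶ Y), W f → W (𝟙 Y)

/-- A projection: a canonical projection from a nonempty finite product to one of its factors. -/
inductive IsProjection : MorphismProperty C
  | proj {ι : Type} [Finite ι] (Z : ι → C) (c : Fan Z) (hc : IsLimit c) (i : ι) :
      IsProjection (c.proj i)

/-- An extended projection: the limit morphism of a natural transformation, all of whose components
are projections, between two diagrams, with given colimits, indexed by a directed poset. -/
inductive IsExtendedProjection : MorphismProperty C
  | mk (J : Type w) [PartialOrder J] [IsDirectedOrder J] [Nonempty J] (F G : J ⥤ C)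
      (c : Cocone F) (hc : IsColimit c) (d : Cocone G) (hd : IsColimit d) (τ : F ⟶ G)
      (hτ : ∀ j, IsProjection (τ.app j)) (f : c.pt ⟶ d.pt)
      (hf : ∀ j, c.ι.app j ≫ f = τ.app j ≫ d.ι.app j) : IsExtendedProjection f

/-- For a poset-indexed diagram `F` and an upper bound `p` of `D`, the cocone with vertex `F p` over
the restriction of `F` to `D`. -/
def upperBoundCocone {I : Type w} [PartialOrder I] (F : I ⥤ C) (D : Set I) (p : I)
    (hp : p ∈ upperBounds D) : Cocone ((Subtype.mono_coe (· ∈ D)).functor ⋙ F) where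
  pt := F.obj p
  ι :=
    { app := fun q => F.map (homOfLE (hp q.2))
      naturality := fun q r h => by
        refine (F.map_comp _ _).symm.trans (Eq.trans ?_ (Category.comp_id _).symm)
        rfl }

/-- A poset-indexed diagram is continuous if `F p = colim (F q : q ∈ D)` for each nonempty directed
subset `D` with least upper bound `p`. -/
def IsContinuousDiagram {I : Type w} [PartialOrder I] (F : I ⥤ C) : Prop :=
  ∀ (D : Set I) (p : I), D.Nonempty → DirectedOn (· ≤ ·) D → ∀ hp : IsLUB D p,
    Nonempty (IsColimit (upperBoundCocone F D p hp.1))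

/-- The poset `[Ω]^{<κ}` of all subsets of `Ω` of cardinality smaller than `κ`. -/
abbrev SmallSubsets (Ω : Type w) (κ : Cardinal.{w}) : Type w := {Y : Set Ω // #Y < κ}

/-- `A` is weakly `κ`-presented: for each set `Ω` and each continuous diagram indexed by `[Ω]^{<κ}`
with colimit `B`, every morphism from `A` to `B` factors through one of the limiting morphisms. -/
def IsWeaklyPresented (κ : Cardinal.{w}) (A : C) : Prop :=
  ∀ (Ω : Type w) (F : SmallSubsets Ω κ ⥤ C), IsContinuousDiagram F →
    ∀ (c : Cocone F), Nonempty (IsColimit c) → ∀ f : A ⟶ c.pt,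
      ∃ (Y : SmallSubsets Ω κ) (g : A ⟶ F.obj Y), g ≫ c.ι.app Y = f

/-- The full subcategory given by `Q` has all `κ`-small directed colimits within `C`. -/
def HasDirectedColimitsWithin (κ : Cardinal.{w}) (Q : ObjectProperty C) : Prop :=
  ∀ (J : Type w) [PartialOrder J] [IsDirectedOrder J] [Nonempty J], #J < κ →
    ∀ F : J ⥤ C, (∀ j, Q (F.obj j)) → ∃ c : Cocone F, Nonempty (IsColimit c) ∧ Q c.pt

/-- The subcategory with class of morphisms `W` is right closed under `κ`-small directed
colimits. -/
def IsRightClosed (κ : Cardinal.{w}) (W : MorphismProperty C) : Prop :=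
  ∀ (J : Type w) [PartialOrder J] [IsDirectedOrder J] [Nonempty J], #J < κ →
    ∀ (F : J ⥤ C) (c : Cocone F), Nonempty (IsColimit c) → ∀ (Y : C) (f : c.pt ⟶ Y),
      (∀ j, W (c.ι.app j ≫ f)) → W f

variable {D : Type u₁} [Category.{v₁} D]

/-- A functor preserves all small directed colimits. -/
def PreservesSmallDirectedColimits (F : C ⥤ D) : Prop :=
  ∀ (J : Type w) [PartialOrder J] [IsDirectedOrder J] [Nonempty J], PreservesColimitsOfShape J F

/-- A functor preserves all `κ`-small directed colimits. -/
def PreservesDirectedColimitsLT (κ : Cardinal.{w}) (F : C ⥤ D) : Prop :=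
  ∀ (J : Type w) [PartialOrder J] [IsDirectedOrder J] [Nonempty J], #J < κ →
    PreservesColimitsOfShape J F

/-- `(a, ε)` is a projectability witness for `φ : Ψ A ⟶ B` with respect to `Ψ`. -/
structure IsProjectabilityWitness (Ψ : C ⥤ D) {A : C} {B : D} (φ : Ψ.obj A ⟶ B) {A' : C}
    (a : A ⟶ A') (ε : Ψ.obj A' ⟶ B) : Prop where
  epi : Epi a
  isIso : IsIso ε
  fac : Ψ.map a ≫ ε = φ
  lift : ∀ (X : C) (f : A ⟶ X) (η : Ψ.obj A' ⟶ Ψ.obj X), Ψ.map f = Ψ.map a ≫ η →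
    ∃ g : A' ⟶ X, f = a ≫ g ∧ η = Ψ.map g

end Categories

/-! ## Larders -/

/-- The octuple `(𝒜, ℬ, 𝒮, 𝒜†, ℬ†, 𝒮⇒, Φ, Ψ)`: functors `Φ : 𝒜 ⥤ 𝒮` and `Ψ : ℬ ⥤ 𝒮`, full
subcategories `𝒜†` of `𝒜` and `ℬ†` of `ℬ`, and a subcategory `𝒮⇒` of `𝒮`, whose morphisms are the
double arrows. -/
structure LarderData (𝒜 : Type u₁) [Category.{v₁} 𝒜] (ℬ : Type u₂) [Category.{v₂} ℬ]
    (𝒮 : Type u₃) [Category.{v₃} 𝒮] where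
  smallA : ObjectProperty 𝒜
  smallB : ObjectProperty ℬ
  double : MorphismProperty 𝒮
  isSubcategory : IsSubcategory double
  Φ : 𝒜 ⥤ 𝒮
  Ψ : ℬ ⥤ 𝒮

namespace LarderData

variable {𝒜 : Type u₁} [Category.{v₁} 𝒜] {ℬ : Type u₂} [Category.{v₂} ℬ]
  {𝒮 : Type u₃} [Category.{v₃} 𝒮] (Λ : LarderData 𝒜 ℬ 𝒮)

/-- The Löwenheim-Skolem condition with index `mu` at `B`. -/
def LowenheimSkolem (mu : Cardinal.{w}) (B : ℬ) : Prop :=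
  ∀ (A : 𝒜), Λ.smallA A → ∀ (ψ : Λ.Ψ.obj B ⟶ Λ.Φ.obj A), Λ.double ψ →
    ∀ (I : Type w), #I < mu → ∀ (Ci : I → ℬ) (γi : ∀ i, Ci i ⟶ B),
      (∀ i, Λ.smallB (Ci i)) → (∀ i, Mono (γi i)) →
      ∃ (Cc : ℬ) (γ : Cc ⟶ B), Λ.smallB Cc ∧ Mono γ ∧
        (∀ i, ∃ h : Ci i ⟶ Cc, h ≫ γ = γi i) ∧ Λ.double (Λ.Ψ.map γ ≫ ψ)

/-- `Λ` is a `(lam, mu)`-larder at the object `B`. -/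
structure IsLarderAt (lam mu : Cardinal.{w}) (B : ℬ) : Prop where
  closA : HasSmallDirectedColimits.{w} 𝒜
  prodA : HasBinaryProducts 𝒜
  cont : PreservesSmallDirectedColimits.{w} Λ.Φ
  proj : ∀ {X Y : 𝒜} (f : X ⟶ Y), IsExtendedProjection.{w} f → Λ.double (Λ.Φ.map f)
  pres : ∀ B' : ℬ, Λ.smallB B' → IsWeaklyPresented lam (Λ.Ψ.obj B')
  ls : Λ.LowenheimSkolem mu B

/-- `Λ` is strong (with respect to `mu`). -/
structure IsStrong (mu : Cardinal.{w}) : Prop where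
  closB : HasDirectedColimitsWithin mu Λ.smallB
  closS : IsRightClosed mu Λ.double
  cont : PreservesDirectedColimitsLT mu Λ.Ψ

/-- `Λ` is projectable: every double arrow `Ψ C ⇒ S` has a projectability witness. -/
def IsProjectable : Prop :=
  ∀ (Cc : ℬ) (S : 𝒮) (φ : Λ.Ψ.obj Cc ⟶ S), Λ.double φ →
    ∃ (C' : ℬ) (a : Cc ⟶ C') (ε : Λ.Ψ.obj C' ⟶ S), IsProjectabilityWitness Λ.Ψ φ a ε

end LarderData

end CLL

/-! An ideal `x` of `X` determines an ultrafilter of `F(X)` (`Holds`), which picks one atom in each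
finite subalgebra. If `p` bounds the norms of the elements of `x`, projecting to the chosen atoms
gives a morphism `evaluation` from the condensate to `A p`. When `p` is the largest norm, the charts
giving the chosen atom the value `p` are cofinal, so `evaluation` is an extended projection
(`isExtendedProjection_evaluation`) and `χ` followed by its image under `Φ` is a double arrow `ρ x`.

The Löwenheim-Skolem condition then yields a buttress: a diagram of objects of `ℬ†` over `B`,
indexed by the sharp ideals of non-maximal norm, whose legs, after `Ψ`, turn every `ρ x` into a
double arrow (`IsLarderAt.exists_buttress`). The three cases of the theorem are three ways to build
it: well-founded recursion in the first two, and colimits of a diagram indexed by finite sets in the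
strong case.

The image under `Ψ` of each object of the buttress is weakly `lam`-presented, so its morphism to `Φ`
of the condensate factors through the colimit over a part of the charts that is controlled by fewer
than `lam` generators. Hence there is a `lam`-small `Z x ⊆ X` such that, seen from that object,
evaluations at two ideals with the same trace on `Z x` coincide (`IsLifter.exists_support`).

Applying the lifter to `Z` gives `σ`. For `p < q` one has `σ p ⊆ σ q` and `Z (σ p) ∩ σ q ⊆ σ p`, so
`σ p` and `σ q` have the same trace on `Z (σ p)`. This is exactly what makes the morphisms `Ψ (B p)
⟶ Φ (A p)` natural, where `B p` is the object of the buttress at `σ p`, or `B` itself if `p` is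
maximal. The projectable case follows by choosing witnesses pointwise
(`IsProjectable.exists_lifting`). -/

namespace CLL

/-! ### Colimits over subsets of a directed poset -/

section DirectedUnions

/-- The inclusion functor of a subset of a poset. -/
abbrev inclusion {J : Type w} [PartialOrder J] (T : Set J) : {j // j ∈ T} ⥤ J :=
  (Subtype.mono_coe (· ∈ T)).functor

theorem isDirectedOrder_of_cofinal {J : Type w} [PartialOrder J] [IsDirectedOrder J] {T : Set J}
    (hT : ∀ j, ∃ t ∈ T, j ≤ t) : IsDirectedOrder {j // j ∈ T} := by
  refine ⟨fun a b => ?_⟩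
  obtain ⟨c, hac, hbc⟩ := exists_ge_ge a.1 b.1
  obtain ⟨t, ht, hct⟩ := hT c
  exact ⟨⟨t, ht⟩, hac.trans hct, hbc.trans hct⟩

theorem final_inclusion {J : Type w} [PartialOrder J] [IsDirectedOrder J] [Nonempty J] {T : Set J}
    (hT : ∀ j, ∃ t ∈ T, j ≤ t) : (inclusion T).Final := by
  have := isDirectedOrder_of_cofinal hT
  have : Nonempty {j // j ∈ T} :=
    let ⟨t, ht, _⟩ := hT (Classical.arbitrary J)
    ⟨⟨t, ht⟩⟩
  refine Functor.final_of_exists_of_isFiltered _ (fun j => ?_) fun {j t} s s' => ?_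
  · obtain ⟨t, ht, hjt⟩ := hT j
    exact ⟨⟨t, ht⟩, ⟨homOfLE hjt⟩⟩
  · exact ⟨t, 𝟙 t, rfl⟩

variable {C : Type u} [Category.{v} C] {J : Type w} [PartialOrder J] (E : J ⥤ C)

/-- The object `L`, with the morphisms `ι`, is a colimit of the restriction of `E` to `T`. -/
structure IsColimitOn (T : Set J) (L : C) (ι : ∀ j ∈ T, E.obj j ⟶ L) : Prop where
  w : ∀ (i j : J) (hi : i ∈ T) (hj : j ∈ T) (h : i ≤ j), E.map (homOfLE h) ≫ ι j hj = ι i hi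
  hom_ext : ∀ (L' : C) (a b : L ⟶ L'), (∀ j hj, ι j hj ≫ a = ι j hj ≫ b) → a = b
  desc : ∀ (L' : C) (f : ∀ j ∈ T, E.obj j ⟶ L'),
    (∀ (i j : J) (hi : i ∈ T) (hj : j ∈ T) (h : i ≤ j), E.map (homOfLE h) ≫ f j hj = f i hi) →
      ∃ l : L ⟶ L', ∀ j hj, ι j hj ≫ l = f j hj

/-- The cocone over the restriction of `E` to `T` with given components. -/
def coconeOn {T : Set J} {L : C} (ι : ∀ j ∈ T, E.obj j ⟶ L)
    (hι : ∀ (i j : J) (hi : i ∈ T) (hj : j ∈ T) (h : i ≤ j),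
      E.map (homOfLE h) ≫ ι j hj = ι i hi) : Cocone (inclusion T ⋙ E) where
  pt := L
  ι :=
    { app := fun j => ι j.1 j.2
      naturality := fun i j h =>
        (hι i.1 j.1 i.2 j.2 (leOfHom h)).trans (Category.comp_id _).symm }

theorem isColimitOn_of_isColimit {T : Set J} {c : Cocone (inclusion T ⋙ E)} (hc : IsColimit c) :
    IsColimitOn E T c.pt fun j hj => c.ι.app ⟨j, hj⟩ where
  w i j hi hj h :=
    c.w (homOfLE (show (⟨i, hi⟩ : {j // j ∈ T}) ≤ ⟨j, hj⟩ from h))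
  hom_ext _ _ _ h := hc.hom_ext fun j => h j.1 j.2
  desc _ f hf := ⟨hc.desc (coconeOn E f hf), fun j hj => hc.fac (coconeOn E f hf) ⟨j, hj⟩⟩

theorem isColimitOn_univ [IsDirectedOrder J] [Nonempty J] {c : Cocone E} (hc : IsColimit c) :
    IsColimitOn E Set.univ c.pt fun j _ => c.ι.app j := by
  have := final_inclusion (J := J) (T := Set.univ) fun j => ⟨j, trivial, le_rfl⟩
  exact isColimitOn_of_isColimit E ((Functor.Final.isColimitWhiskerEquiv _ c).symm hc)

/-- The vertex and legs are given separately from the cocone, so that callers may state them in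
whatever form their other data have. -/
theorem nonempty_isColimit {K : Type w} [Preorder K] {F : K ⥤ C} (s : Cocone F) {L : C}
    (σ : ∀ k, F.obj k ⟶ L) (hL : s.pt = L) (hσ : ∀ k, s.ι.app k = σ k ≫ eqToHom hL.symm)
    (hom_ext : ∀ (L' : C) (a b : L ⟶ L'), (∀ k, σ k ≫ a = σ k ≫ b) → a = b)
    (desc : ∀ (L' : C) (f : ∀ k, F.obj k ⟶ L'),
      (∀ (k k' : K) (h : k ≤ k'), F.map (homOfLE h) ≫ f k' = f k) →
        ∃ l : L ⟶ L', ∀ k, σ k ≫ l = f k) : Nonempty (IsColimit s) := by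
  obtain ⟨pt, ι⟩ := s
  dsimp only at hL hσ
  subst hL
  have hσ' : ∀ k, ι.app k = σ k := fun k => (hσ k).trans (Category.comp_id _)
  choose l hl using fun s' : Cocone F =>
    desc s'.pt (fun k => s'.ι.app k) fun k k' h => s'.w (homOfLE h)
  exact ⟨{
    desc := l
    fac := fun s' k => by
      rw [hσ']
      exact hl s' k
    uniq := fun s' m hm => hom_ext _ _ _ fun k => by
      rw [hl, ← hm k, hσ' k] }⟩

/-- If `T` is the directed union of the `t k`, then the colimit of `E` over `T` is the colimit of
the colimits of `E` over the `t k`. -/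
theorem isColimit_of_directed_union {K : Type w} [PartialOrder K] [IsDirectedOrder K]
    {F : K ⥤ C} (s : Cocone F) {L : C} (σ : ∀ k, F.obj k ⟶ L) (hL : s.pt = L)
    (hσ : ∀ k, s.ι.app k = σ k ≫ eqToHom hL.symm) (T : Set J)
    (c : ∀ j ∈ T, E.obj j ⟶ L) (hc : IsColimitOn E T L c)
    (t : K → Set J) (htm : Monotone t) (htT : ∀ k, t k ⊆ T) (hTt : ∀ j ∈ T, ∃ k, j ∈ t k)
    (d : ∀ (k : K), ∀ j ∈ t k, E.obj j ⟶ F.obj k) (hd : ∀ k, IsColimitOn E (t k) (F.obj k) (d k))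
    (hds : ∀ (k : K) (j : J) (hj : j ∈ t k), d k j hj ≫ σ k = c j (htT k hj))
    (hdd : ∀ (k k' : K) (h : k ≤ k') (j : J) (hj : j ∈ t k),
      d k j hj ≫ F.map (homOfLE h) = d k' j (htm h hj)) :
    Nonempty (IsColimit s) := by
  choose κ hκ using hTt
  refine nonempty_isColimit s σ hL hσ (fun L' a b h => ?_) fun L' f hf => ?_
  · refine hc.hom_ext _ _ _ fun j hj => ?_
    rw [← hds _ j (hκ j hj), Category.assoc, Category.assoc, h]
  -- Each `j` lies in many pieces; directedness of `K` shows that the morphism out of `E j` does not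
  -- depend on the piece chosen.
  · have key : ∀ (j : J) (k k' : K) (hk : j ∈ t k) (hk' : j ∈ t k'),
        d k j hk ≫ f k = d k' j hk' ≫ f k' := by
      intro j k k' hk hk'
      obtain ⟨l, hl, hl'⟩ := exists_ge_ge k k'
      rw [← hf _ _ hl, ← hf _ _ hl', ← Category.assoc, ← Category.assoc, hdd _ _ hl, hdd _ _ hl']
    obtain ⟨l, hl⟩ := hc.desc L' (fun j hj => d (κ j hj) j (hκ j hj) ≫ f (κ j hj)) (by
      intro i j hi hj hij
      obtain ⟨m, hm, hm'⟩ := exists_ge_ge (κ i hi) (κ j hj)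
      rw [key i _ m _ (htm hm (hκ i hi)), key j _ m _ (htm hm' (hκ j hj)), ← Category.assoc,
        (hd m).w])
    refine ⟨l, fun k => (hd k).hom_ext _ _ _ fun j hj => ?_⟩
    rw [← Category.assoc, hds, hl]
    exact key _ _ _ _ _

variable {K : Type w} [PartialOrder K] (T : K → Set J) (hT : Monotone T)

/-- Transition morphisms come from the universal property, and functoriality from its uniqueness
part. -/
theorem exists_unionDiagram
    (hcol : ∀ k, ∃ (L : C) (ι : ∀ j ∈ T k, E.obj j ⟶ L), IsColimitOn E (T k) L ι) :
    ∃ (F : K ⥤ C) (d : ∀ (k : K), ∀ j ∈ T k, E.obj j ⟶ F.obj k),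
      (∀ k, IsColimitOn E (T k) (F.obj k) (d k)) ∧
      ∀ (k k' : K) (h : k ≤ k') (j : J) (hj : j ∈ T k),
        d k j hj ≫ F.map (homOfLE h) = d k' j (hT h hj) := by
  choose L d hd using hcol
  choose m hm using fun (k k' : K) (h : k ≤ k') => (hd k).desc (L k')
    (fun j hj => d k' j (hT h hj)) fun i j hi hj hij => (hd k').w i j _ _ hij
  refine ⟨{
    obj := L
    map := fun {k k'} h => m k k' (leOfHom h)
    map_id := fun k => (hd k).hom_ext _ _ _ fun j hj => by
      rw [hm, Category.comp_id]
    map_comp := fun f g => (hd _).hom_ext _ _ _ fun j hj => by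
      rw [hm, ← Category.assoc, hm, hm] }, d, hd, fun k k' h j hj => hm k k' h j hj⟩

end DirectedUnions

/-! ### Continuous coverings and factorization of weakly presented objects -/

theorem isDirectedOrder_smallSubsets (Ω : Type w) {κ : Cardinal.{w}} (hκ : ℵ₀ ≤ κ) :
    IsDirectedOrder (SmallSubsets Ω κ) :=
  ⟨fun Y Z => ⟨⟨Y.1 ∪ Z.1, (mk_union_le _ _).trans_lt (add_lt_of_lt hκ Y.2 Z.2)⟩,
    Set.subset_union_left, Set.subset_union_right⟩⟩

instance nonempty_smallSubsets (Ω : Type w) {κ : Cardinal.{w}} [Fact (ℵ₀ ≤ κ)] :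
    Nonempty (SmallSubsets Ω κ) :=
  ⟨⟨∅, by
    rw [mk_eq_zero]
    exact aleph0_pos.trans_le Fact.out⟩⟩

/-- A covering of a directed poset `J` by directed subsets, indexed by the poset of all `κ`-small
subsets of a set and preserving directed suprema. -/
structure ContinuousCovering (κ : Cardinal.{w}) (J : Type w) [PartialOrder J] where
  index : Type w
  piece : SmallSubsets index κ → Set J
  mono : Monotone piece
  nonempty : ∀ Y, (piece Y).Nonempty
  directed : ∀ Y, DirectedOn (· ≤ ·) (piece Y)
  cover : ∀ j, ∃ Y, j ∈ piece Y
  continuous : ∀ (D : Set (SmallSubsets index κ)) (p), D.Nonempty → DirectedOn (· ≤ ·) D →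
    IsLUB D p → ∀ j ∈ piece p, ∃ Y ∈ D, j ∈ piece Y

/-- Recursion on the finite set: it has finitely many elements and finitely many proper subsets, so
directedness bounds the former together with all values already chosen. -/
theorem exists_monotone_finset {J : Type w} [PartialOrder J] [IsDirectedOrder J] [Nonempty J] :
    ∃ u : Finset J → J, Monotone u ∧ ∀ s, ∀ j ∈ s, j ≤ u s := by
  classical
  have step : ∀ (s : Finset J) (v : ∀ t, t < s → J),
      ∃ j, (∀ i ∈ s, i ≤ j) ∧ ∀ t h, v t h ≤ j := by
    intro s v
    have hfin : (Set.Finite {t | t < s}) := Set.finite_Iio s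
    have := hfin.to_subtype
    obtain ⟨i, hi⟩ := s.exists_le
    obtain ⟨k, hk⟩ := Finite.exists_le fun t : {t | t < s} => v t.1 t.2
    obtain ⟨j, hij, hkj⟩ := exists_ge_ge i k
    exact ⟨j, fun a ha => (hi a ha).trans hij, fun t h => (hk ⟨t, h⟩).trans hkj⟩
  choose j h₁ h₂ using step
  let u : Finset J → J := WellFounded.fix (wellFounded_lt (α := Finset J)) j
  have hu : ∀ s, u s = j s fun t _ => u t := fun s => WellFounded.fix_eq _ _ s
  refine ⟨u, fun s t h => ?_, fun s i hi => ?_⟩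
  · rcases h.eq_or_lt with rfl | h
    · exact le_rfl
    · rw [hu t]
      exact h₂ t (fun s _ => u s) s h
  · rw [hu s]
    exact h₁ s _ i hi

/-- The set is `J` itself, and the piece of `Y` is the lower set generated by the bounds `u s` of
the finite `s ⊆ Y`. Monotonicity of `u` makes it directed. Continuity holds because a finite subset
of a directed union already lies in one member. -/
theorem exists_continuousCovering_of_aleph0_lt {κ : Cardinal.{w}} (hκ : ℵ₀ < κ) (J : Type w)
    [PartialOrder J] [IsDirectedOrder J] [Nonempty J] :
    ∃ T : ContinuousCovering κ J,
      ∀ Y, ∃ U : Set J, #U < κ ∧ ∀ j ∈ T.piece Y, ∃ k ∈ U, j ≤ k := by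
  classical
  obtain ⟨u, hu, hmem⟩ := exists_monotone_finset (J := J)
  have hdirU : ∀ (D : Set (SmallSubsets J κ)), D.Nonempty →
      DirectedOn (· ≤ ·) D → ∀ s : Finset J, (∀ f ∈ s, ∃ Y ∈ D, f ∈ Y.1) →
        ∃ Y ∈ D, (s : Set J) ⊆ Y.1 := by
    intro D hne hD s
    induction s using Finset.induction_on with
    | empty =>
      obtain ⟨Y, hY⟩ := hne
      exact fun _ => ⟨Y, hY, by simp⟩
    | insert f s _ ih =>
      intro h
      obtain ⟨Y, hY, hsY⟩ := ih fun g hg => h g (Finset.mem_insert_of_mem hg)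
      obtain ⟨Y', hY', hf⟩ := h f (Finset.mem_insert_self f s)
      obtain ⟨W, hW, hYW, hYW'⟩ := hD Y hY Y' hY'
      refine ⟨W, hW, ?_⟩
      rw [Finset.coe_insert]
      exact Set.insert_subset (hYW' hf) (hsY.trans hYW)
  have hsingle : ∀ j : J, #({j} : Set J) < κ := fun j =>
    (lt_aleph0_iff_set_finite.2 (Set.finite_singleton j)).trans hκ
  refine ⟨{
    index := J
    piece := fun Y => {f | ∃ s : Finset J, (s : Set J) ⊆ Y.1 ∧ f ≤ u s}
    mono := fun Y W h f ⟨s, hs, hf⟩ => ⟨s, hs.trans h, hf⟩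
    nonempty := fun Y => ⟨u ∅, ∅, by simp, le_rfl⟩
    directed := fun Y f ⟨s, hs, hf⟩ g ⟨t, ht, hg⟩ =>
      ⟨u (s ∪ t), ⟨s ∪ t, by simpa using ⟨hs, ht⟩, le_rfl⟩,
        hf.trans (hu Finset.subset_union_left), hg.trans (hu Finset.subset_union_right)⟩
    cover := fun f => ⟨⟨{f}, hsingle f⟩, {f}, by simp, hmem _ f (by simp)⟩
    continuous := fun D p hne hD hp f ⟨s, hs, hf⟩ => ?_ }, fun Y => ?_⟩
  · have hsub : (⋃ Y ∈ D, Y.1) ⊆ p.1 := Set.iUnion₂_subset fun Y hY => hp.1 hY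
    have hle : p.1 ⊆ ⋃ Y ∈ D, Y.1 :=
      -- The union of `D` is contained in `p`, hence is `κ`-small; so it is an upper bound within
      -- the poset and equals `p`.
      hp.2 (show (⟨_, (mk_le_mk_of_subset hsub).trans_lt p.2⟩ : SmallSubsets J κ) ∈ upperBounds D
        from fun Y hY => Set.subset_biUnion_of_mem (u := fun Y : SmallSubsets J κ => Y.1) hY)
    obtain ⟨Y, hY, hsY⟩ := hdirU D hne hD s fun g hg => by
      simpa using hle (hs hg)
    exact ⟨Y, hY, s, hsY, hf⟩
  -- The generators `u s` are cofinal in the piece; there are at most as many as finite subsets of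
  -- `Y`, that is, finitely many or at most `#Y`.
  · refine ⟨Set.range fun s : Finset Y.1 => u (s.map (Function.Embedding.subtype _)), ?_, ?_⟩
    · refine mk_range_le.trans_lt ?_
      rcases finite_or_infinite Y.1 with h | h
      · exact (lt_aleph0_of_finite _).trans hκ
      · rw [mk_finset_of_infinite]
        exact Y.2
    · rintro f ⟨s, hs, hf⟩
      refine ⟨_, ⟨s.subtype (· ∈ Y.1), rfl⟩, ?_⟩
      dsimp only
      rwa [Finset.subtype_map_of_mem fun x hx => hs hx]

/-- The colimits of `E` over the pieces form a diagram on the `κ`-small subsets, whose colimit is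
that of `E` since the pieces cover `J`. It is continuous since pieces turn directed suprema into
unions, and `Φ` preserves all of this, so weak presentability applies. Of the universal property of
`L` only joint epimorphy of the `ι j` is recorded, as this suffices to compare morphisms out of `L`.
-/
theorem exists_factorization {C : Type u} [Category.{v} C] {D : Type u₁} [Category.{v₁} D]
    {κ : Cardinal.{w}} (hκ : ℵ₀ ≤ κ) {J : Type w} [PartialOrder J] [IsDirectedOrder J] [Nonempty J]
    (hC : HasSmallDirectedColimits.{w} C) {Φ : C ⥤ D} (hΦ : PreservesSmallDirectedColimits.{w} Φ)
    (T : ContinuousCovering κ J) (E : J ⥤ C) {c : Cocone E} (hc : IsColimit c) {S : D}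
    (hS : IsWeaklyPresented κ S) (f : S ⟶ Φ.obj c.pt) :
    ∃ (Y : SmallSubsets T.index κ) (L : C) (ι : ∀ j ∈ T.piece Y, E.obj j ⟶ L)
      (l : L ⟶ c.pt) (g : S ⟶ Φ.obj L),
      (∀ (L' : C) (a b : L ⟶ L'), (∀ j hj, ι j hj ≫ a = ι j hj ≫ b) → a = b) ∧
      (∀ j hj, ι j hj ≫ l = c.ι.app j) ∧ g ≫ Φ.map l = f := by
  have : Fact (ℵ₀ ≤ κ) := ⟨hκ⟩
  have := isDirectedOrder_smallSubsets T.index hκ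
  obtain ⟨F, d, hd, hdd⟩ := exists_unionDiagram E T.piece T.mono fun Y => by
    have : Nonempty {j // j ∈ T.piece Y} := (T.nonempty Y).to_subtype
    have := (T.directed Y).isDirectedOrder
    have := hC {j // j ∈ T.piece Y}
    exact ⟨_, _, isColimitOn_of_isColimit E (colimit.isColimit (inclusion (T.piece Y) ⋙ E))⟩
  have hcE := isColimitOn_univ E hc
  choose l hl using fun Y => (hd Y).desc c.pt (fun j _ => c.ι.app j)
    fun i j _ _ h => c.w (homOfLE h)
  let s : Cocone F :=
    { pt := c.pt
      ι :=
        { app := l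
          naturality := fun Y Z h => by
            refine Eq.trans ?_ (Category.comp_id _).symm
            refine (hd Y).hom_ext _ _ _ fun j hj => ?_
            rw [hl, ← Category.assoc]
            exact (congrArg (· ≫ l Z) (hdd Y Z (leOfHom h) j hj)).trans (hl _ _ _) } }
  obtain ⟨hu⟩ := isColimit_of_directed_union E s l rfl (fun k => (Category.comp_id _).symm)
    Set.univ _ hcE T.piece T.mono (fun _ => Set.subset_univ _) (fun j _ => T.cover j) d hd hl hdd
  have := hΦ (SmallSubsets T.index κ)
  have hcont : IsContinuousDiagram (F ⋙ Φ) := by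
    intro D p hne hD hp
    have : Nonempty {k // k ∈ D} := hne.to_subtype
    have := hD.isDirectedOrder
    obtain ⟨h⟩ := isColimit_of_directed_union E (upperBoundCocone F D p hp.1)
      (fun k : {k // k ∈ D} => F.map (homOfLE (hp.1 k.2))) rfl
      (fun k => (Category.comp_id _).symm) (T.piece p) (d p) (hd p)
      (fun k : {k // k ∈ D} => T.piece k.1) (fun a b h => T.mono h) (fun k => T.mono (hp.1 k.2))
      (fun j hj => by
        obtain ⟨k, hk, h⟩ := T.continuous D p hne hD hp j hj
        exact ⟨⟨k, hk⟩, h⟩)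
      (fun k => d k.1) (fun k => hd k.1) (fun k j hj => hdd _ _ _ j hj)
      (fun k k' h j hj => hdd _ _ _ j hj)
    have := hΦ {k // k ∈ D}
    exact ⟨isColimitOfPreserves Φ h⟩
  obtain ⟨Y, g, hg⟩ := hS T.index _ hcont (Φ.mapCocone s) ⟨isColimitOfPreserves Φ hu⟩ f
  exact ⟨Y, F.obj Y, d Y, l Y, g, (hd Y).hom_ext, hl Y, hg⟩

/-! ### Buttresses -/

namespace LarderData

variable {𝒜 : Type u₁} [Category.{v₁} 𝒜] {ℬ : Type u₂} [Category.{v₂} ℬ]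
  {𝒮 : Type u₃} [Category.{v₃} 𝒮] (Λ : LarderData 𝒜 ℬ 𝒮)

/-- A buttress of a family of morphisms `ψ x : Ψ B ⟶ S x`: a diagram of objects of `ℬ†` over `B`
that turn each `ψ x` into a double arrow. -/
structure Buttress {Q : Type w} [PartialOrder Q] {B : ℬ} {S : Q → 𝒮}
    (ψ : ∀ x, Λ.Ψ.obj B ⟶ S x) where
  diag : Q ⥤ ℬ
  leg : ∀ x, diag.obj x ⟶ B
  w : ∀ {x y : Q} (h : x ⟶ y), diag.map h ≫ leg y = leg x
  small : ∀ x, Λ.smallB (diag.obj x)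
  double : ∀ x, Λ.double (Λ.Ψ.map (leg x) ≫ ψ x)

variable {Λ} {mu : Cardinal.{w}} {B : ℬ}

/-- Well-founded recursion: at `x`, the Löwenheim-Skolem condition is applied to all subobjects
chosen strictly below `x`. As the legs are monic, transition morphisms over `B` are unique, which
gives functoriality. -/
theorem LowenheimSkolem.nonempty_buttress (hLS : Λ.LowenheimSkolem mu B) {Q : Type w}
    [PartialOrder Q] [WellFoundedLT Q] (hQ : ∀ x : Q, #{y : Q // y < x} < mu)
    (A : Q → 𝒜) (hA : ∀ x, Λ.smallA (A x)) (ψ : ∀ x, Λ.Ψ.obj B ⟶ Λ.Φ.obj (A x))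
    (hψ : ∀ x, Λ.double (ψ x)) : Nonempty (Λ.Buttress ψ) := by
  let Sub := {s : Σ Cc : ℬ, Cc ⟶ B // Λ.smallB s.1 ∧ Mono s.2}
  have step : ∀ (x : Q) (s : ∀ y : Q, y < x → Sub), ∃ t : Sub,
      (∀ y h, ∃ f : (s y h).1.1 ⟶ t.1.1, f ≫ t.1.2 = (s y h).1.2) ∧
        Λ.double (Λ.Ψ.map t.1.2 ≫ ψ x) := by
    intro x s
    obtain ⟨Cc, γ, h1, h2, h3, h4⟩ := hLS (A x) (hA x) (ψ x) (hψ x) {y : Q // y < x} (hQ x)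
      (fun y => (s y.1 y.2).1.1) (fun y => (s y.1 y.2).1.2) (fun y => (s y.1 y.2).2.1)
      (fun y => (s y.1 y.2).2.2)
    exact ⟨⟨⟨Cc, γ⟩, h1, h2⟩, fun y h => h3 ⟨y, h⟩, h4⟩
  choose t ht₁ ht₂ using step
  let c : Q → Sub := WellFounded.fix (wellFounded_lt (α := Q)) t
  have hc : ∀ x, c x = t x fun y _ => c y := fun x => WellFounded.fix_eq _ _ x
  have hmono : ∀ x, Mono (c x).1.2 := fun x => (c x).2.2
  have hle : ∀ x y : Q, x ≤ y → ∃ f : (c x).1.1 ⟶ (c y).1.1, f ≫ (c y).1.2 = (c x).1.2 := by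
    intro x y h
    rcases h.eq_or_lt with rfl | h
    · exact ⟨𝟙 _, Category.id_comp _⟩
    · have := ht₁ y (fun z _ => c z) x h
      rwa [← hc] at this
  choose m hm using hle
  refine ⟨{
    diag :=
      { obj := fun x => (c x).1.1
        map := fun {x y} h => m x y (leOfHom h)
        map_id := fun x => by
          rw [← cancel_mono (c x).1.2, hm, Category.id_comp]
        map_comp := fun f g => by
          rw [← cancel_mono (c _).1.2, hm, Category.assoc, hm, hm] }
    leg := fun x => (c x).1.2
    w := fun h => hm _ _ (leOfHom h)
    small := fun x => (c x).2.1
    double := fun x => ?_ }⟩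
  have := ht₂ x fun z _ => c z
  rwa [← hc] at this

/-- Without well-foundedness of `Q`, the recursion runs over the finite subsets of `Q` with a
greatest element, a lower finite poset. The object at `x` is then the colimit over the finite sets
with greatest element `x`. These form a directed `mu`-small poset, so strength keeps the colimit in
`ℬ†` and its leg, composed with `ψ x`, a double arrow. -/
theorem IsStrong.nonempty_buttress (hstr : Λ.IsStrong mu) (hmu : ℵ₀ ≤ mu)
    (hLS : Λ.LowenheimSkolem mu B) {Q : Type w}
    [PartialOrder Q] (hQ : ∀ x : Q, #{y : Q // y ≤ x} < mu)
    (A : Q → 𝒜) (hA : ∀ x, Λ.smallA (A x)) (ψ : ∀ x, Λ.Ψ.obj B ⟶ Λ.Φ.obj (A x))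
    (hψ : ∀ x, Λ.double (ψ x)) : Nonempty (Λ.Buttress ψ) := by
  classical
  let R := {F : Finset Q // ∃ x, IsGreatest (F : Set Q) x}
  have : WellFoundedLT R := ⟨InvImage.wf Subtype.val (wellFounded_lt (α := Finset Q))⟩
  choose top htop using fun F : R => F.2
  have hlt : ∀ F : R, #{G : R // G < F} < mu := fun F => by
    refine lt_of_lt_of_le ?_ hmu
    rw [lt_aleph0_iff_finite]
    have hfin : Set.Finite {G : R | G < F} := by
      refine Set.Finite.of_finite_image (f := Subtype.val)
        ((Finset.finite_toSet F.1.powerset).subset ?_) Subtype.val_injective.injOn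
      rintro _ ⟨G, hG, rfl⟩
      exact Finset.mem_coe.2 (Finset.mem_powerset.2 (Subtype.coe_le_coe.2 (le_of_lt hG)))
    exact hfin.to_subtype
  obtain ⟨b⟩ := hLS.nonempty_buttress hlt (fun F => A (top F)) (fun F => hA _)
    (fun F => ψ (top F)) (fun F => hψ _)
  let K : Q → Set R := fun x => {F | IsGreatest (F.1 : Set Q) x}
  have htopK : ∀ (x : Q) (F : R), F ∈ K x → top F = x := fun x F h => (htop F).unique h
  have hne : ∀ x, Nonempty (K x) := fun x =>
    have h : IsGreatest (({x} : Finset Q) : Set Q) x := by simp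
    ⟨⟨⟨{x}, x, h⟩, h⟩⟩
  have hunion : ∀ x, ∀ F ∈ K x, ∀ G ∈ K x, ∃ H ∈ K x, F ≤ H ∧ G ≤ H := by
    intro x F hF G hG
    have h : IsGreatest ((F.1 ∪ G.1 : Finset Q) : Set Q) x := by
      rw [Finset.coe_union]
      exact ⟨Or.inl hF.1, fun z hz => hz.elim (fun h => hF.2 h) fun h => hG.2 h⟩
    exact ⟨⟨F.1 ∪ G.1, x, h⟩, h, Finset.subset_union_left, Finset.subset_union_right⟩
  have hdir : ∀ x, IsDirectedOrder (K x) := fun x =>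
    ⟨fun F G => by
      obtain ⟨H, hH, h⟩ := hunion x F.1 F.2 G.1 G.2
      exact ⟨⟨H, hH⟩, h⟩⟩
  have hcard : ∀ x, #(K x) < mu := fun x => by
    have h1 : #(K x) ≤ #(Finset {y : Q // y ≤ x}) := by
      refine mk_le_of_injective (f := fun F => F.1.1.subtype (· ≤ x)) fun F G h => ?_
      refine Subtype.ext (Subtype.ext (Finset.ext fun a => ?_))
      by_cases ha : a ≤ x
      · have := Finset.ext_iff.1 h ⟨a, ha⟩
        simpa [Finset.mem_subtype] using this
      · exact ⟨fun h => absurd (F.2.2 h) ha, fun h => absurd (G.2.2 h) ha⟩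
    refine h1.trans_lt ?_
    rcases finite_or_infinite {y : Q // y ≤ x} with h | h
    · exact (lt_aleph0_of_finite _).trans_le hmu
    · rw [mk_finset_of_infinite]
      exact hQ x
  choose c hc hcs using fun x => hstr.closB (K x) (hcard x) (inclusion (K x) ⋙ b.diag)
    fun F => b.small _
  obtain ⟨ι, hι, hιc⟩ : ∃ ι : ∀ (x : Q), ∀ F ∈ K x, b.diag.obj F ⟶ (c x).pt,
      (∀ x, IsColimitOn b.diag (K x) (c x).pt (ι x)) ∧
        ∀ x F hF, (c x).ι.app ⟨F, hF⟩ = ι x F hF :=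
    ⟨_, fun x => isColimitOn_of_isColimit b.diag (hc x).some, fun _ _ _ => rfl⟩
  have exists_le : ∀ (x y : Q), x ≤ y → ∀ F ∈ K x, ∃ G ∈ K y, F ≤ G := by
    intro x y h F hF
    have hg : IsGreatest ((insert y F.1 : Finset Q) : Set Q) y := by
      refine ⟨by simp, fun z hz => ?_⟩
      rcases Finset.mem_insert.1 hz with rfl | hz
      · exact le_rfl
      · exact (hF.2 hz).trans h
    exact ⟨⟨insert y F.1, y, hg⟩, hg, Finset.subset_insert _ _⟩
  choose leg hleg using fun x => (hι x).desc B (fun F _ => b.leg F) fun F G _ _ h =>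
    b.w (homOfLE h)
  have trans : ∀ (x y : Q) (h : x ≤ y), ∃ m : (c x).pt ⟶ (c y).pt,
      ∀ (F : R) (hF : F ∈ K x) (G : R) (hG : G ∈ K y) (hFG : F ≤ G),
        ι x F hF ≫ m = b.diag.map (homOfLE hFG) ≫ ι y G hG := by
    intro x y h
    -- The choice of a larger set in `K y` is immaterial because `K y` is directed.
    have hind : ∀ (F G G' : R) (hG : G ∈ K y) (hG' : G' ∈ K y) (h : F ≤ G) (h' : F ≤ G'),
        b.diag.map (homOfLE h) ≫ ι y G hG = b.diag.map (homOfLE h') ≫ ι y G' hG' := by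
      intro F G G' hG hG' h h'
      obtain ⟨H, hH, h1, h2⟩ := hunion y G hG G' hG'
      rw [← (hι y).w G H hG hH h1, ← (hι y).w G' H hG' hH h2, ← Category.assoc,
        ← Category.assoc, ← b.diag.map_comp, ← b.diag.map_comp]
      rfl
    choose G hG hFG using exists_le x y h
    obtain ⟨m, hm⟩ := (hι x).desc (c y).pt
      (fun F hF => b.diag.map (homOfLE (hFG F hF)) ≫ ι y (G F hF) (hG F hF)) (by
        intro F F' hF hF' hFF'
        rw [← Category.assoc, ← b.diag.map_comp]
        exact hind _ _ _ _ _ (hFF'.trans (hFG F' hF')) _)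
    exact ⟨m, fun F hF G' hG' h' => (hm F hF).trans (hind _ _ _ _ _ _ _)⟩
  choose m hm using trans
  refine ⟨{
    diag :=
      { obj := fun x => (c x).pt
        map := fun {x y} h => m x y (leOfHom h)
        map_id := fun x => (hι x).hom_ext _ _ _ fun F hF => by
          rw [hm x x le_rfl F hF F hF le_rfl, Category.comp_id]
          exact (hι x).w F F hF hF le_rfl
        map_comp := fun {x y z} f g => (hι x).hom_ext _ _ _ fun F hF => by
          obtain ⟨G, hG, h1⟩ := exists_le x y (leOfHom f) F hF
          obtain ⟨H, hH, h2⟩ := exists_le y z (leOfHom g) G hG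
          rw [hm x z _ F hF H hH (h1.trans h2), ← Category.assoc, hm x y _ F hF G hG h1,
            Category.assoc, hm y z _ G hG H hH h2, ← Category.assoc, ← b.diag.map_comp]
          rfl }
    leg := leg
    w := fun {x y} h => (hι x).hom_ext _ _ _ fun F hF => by
      obtain ⟨G, hG, h1⟩ := exists_le x y (leOfHom h) F hF
      rw [hleg, ← Category.assoc, hm x y _ F hF G hG h1, Category.assoc, hleg, b.w]
    small := hcs
    double := fun x => ?_ }⟩
  have := hdir x
  have := hstr.cont (K x) (hcard x)
  refine hstr.closS (K x) (hcard x) (inclusion (K x) ⋙ b.diag ⋙ Λ.Ψ) (Λ.Ψ.mapCocone (c x))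
    ⟨isColimitOfPreserves Λ.Ψ (hc x).some⟩ _ _ fun F => ?_
  have h1 := b.double F.1
  have h2 : Λ.Ψ.map (b.leg F.1) ≫ ψ x = Λ.Ψ.map (ι x F.1 F.2) ≫ Λ.Ψ.map (leg x) ≫ ψ x := by
    rw [← hleg x F.1 F.2, Λ.Ψ.map_comp, Category.assoc]
  -- `top F` equals `x` only propositionally, so the double arrow has to be transported.
  have h3 : ∀ z, z = x → Λ.double (Λ.Ψ.map (b.leg F.1) ≫ ψ z) →
      Λ.double (Λ.Ψ.map (b.leg F.1) ≫ ψ x) := by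
    rintro z rfl h
    exact h
  have h4 := h3 _ (htopK x F.1 F.2) h1
  rw [h2, ← hιc x F.1 F.2] at h4
  exact h4

end LarderData

/-! ### Ideals of `X` as ultrafilters of `F(X)` -/

namespace NormCovering

variable {P : Type w} [PartialOrder P] {X : NormCovering P}

/-- Each kind of relation reflects one property of ideals: lower set for the order, directedness for
meets, nonemptiness for the unit. -/
theorem rel_eval (x : Order.Ideal X) (s t : BoolTerm X) (h : X.Rel s t) :
    BoolTerm.eval (fun u : X => u ∈ x) s = BoolTerm.eval (fun u : X => u ∈ x) t := by
  cases h with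
  | @antitone u v h => exact propext ⟨fun h' => h'.1, fun h' => ⟨h', x.lower h h'⟩⟩
  | inf u v l hl =>
    rw [eval_listSup]
    change (u ∈ x ∧ v ∈ x) = _
    apply propext
    constructor
    · rintro ⟨hu, hv⟩
      obtain ⟨z, hz, huz, hvz⟩ := x.directed u hu v hv
      have hz' : z ∈ upperBounds ({u, v} : Set X) := by
        rintro y (rfl | rfl)
        · exact huz
        · exact hvz
      obtain ⟨b, hb, hbz⟩ := upperBounds_subset_of_pjs X.pjs (Or.inr ⟨u, v, rfl⟩) hz'
      exact ⟨b, (hl b).2 hb, x.lower hbz hz⟩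
    · rintro ⟨b, hb, hbx⟩
      have hb' := (hl b).1 hb
      exact ⟨x.lower (hb'.1 (by simp)) hbx, x.lower (hb'.1 (by simp)) hbx⟩
  | top l hl =>
    rw [eval_listSup]
    change True = _
    obtain ⟨z, hz⟩ := x.nonempty
    obtain ⟨b, hb, hbz⟩ := upperBounds_subset_of_pjs X.pjs (Y := (∅ : Set X)) (Or.inl rfl)
      (a := z) (by simp)
    exact (eq_true ⟨b, (hl b).2 ((X.isMin_iff_nabla_empty b).2 hb), x.lower hbz hz⟩).symm

/-- The ultrafilter of `F(X)` associated with an ideal `x` of `X`; it contains the generator `ũ` if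
and only if `u ∈ x`. -/
def Holds (x : Order.Ideal X) : X.scaled → Prop :=
  PresentedBool.lift (fun u : X => u ∈ x) (rel_eval x)

section Holds

variable (x : Order.Ideal X) (a b : X.scaled)

theorem holds_top : Holds x ⊤ := trivial

theorem not_holds_bot : ¬ Holds x ⊥ := fun h => h

theorem holds_sup : Holds x (a ⊔ b) ↔ Holds x a ∨ Holds x b :=
  Quotient.inductionOn₂ a b fun _ _ => Iff.rfl

theorem holds_inf : Holds x (a ⊓ b) ↔ Holds x a ∧ Holds x b :=
  Quotient.inductionOn₂ a b fun _ _ => Iff.rfl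

theorem holds_compl : Holds x aᶜ ↔ ¬ Holds x a :=
  Quotient.inductionOn a fun _ => Iff.rfl

variable {a b}

theorem Holds.mono {x : Order.Ideal X} (ha : Holds x a) (h : a ≤ b) : Holds x b := by
  rw [← inf_eq_left.2 h, holds_inf] at ha
  exact ha.2

theorem holds_finset_sup (s : Finset X.scaled) : Holds x (s.sup id) ↔ ∃ a ∈ s, Holds x a := by
  classical
  induction s using Finset.induction_on with
  | empty => simpa using not_holds_bot x
  | insert a s _ ih => simp [holds_sup, ih]

theorem holds_finset_inf {ι : Type*} (s : Finset ι) (g : ι → X.scaled) :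
    Holds x (s.inf g) ↔ ∀ i ∈ s, Holds x (g i) := by
  classical
  induction s using Finset.induction_on with
  | empty => simpa using holds_top x
  | insert a s _ ih => simp [holds_inf, ih]

/-- Every ultrafilter comes from an ideal of `X`, namely the set of all `u` whose generator lies
outside `J`. It is nonempty since the generators generate the unit ideal, and directed since a meet
of two generators lies in any ideal containing the generators of all common upper bounds. -/
theorem exists_ideal_of_isPrime {J : Order.Ideal X.scaled} (hJ : J.IsPrime) :
    ∃ x : Order.Ideal X, ∀ a, Holds x a ↔ a ∉ J := by
  have htop : (⊤ : X.scaled) ∉ J := fun h =>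
    hJ.toIsProper.ne_univ (Set.eq_univ_of_forall fun a => J.lower le_top h)
  let x : Order.Ideal X :=
    { carrier := {u | (X.gen u : X.scaled) ∉ J}
      lower' := fun u v h hu hv => hu (J.lower (X.gen_anti h) hv)
      nonempty' := by
        by_contra hne
        have hall : ∀ u : X, X.gen u ∈ J := fun u => by
          by_contra hu
          exact hne ⟨u, hu⟩
        have h1 : (⊤ : Order.Ideal X.freeBool) ≤ J := by
          rw [← X.iSup_freeIdeal]
          exact iSup_le fun p => X.freeIdeal_le fun u _ => hall u
        exact htop (h1 trivial)
      directed' := by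
        intro u hu v hv
        by_contra hne
        have h1 : X.gen u ⊓ X.gen v ∈ J := X.gen_inf_gen_mem u v fun z hz hz' => by
          by_contra h
          exact hne ⟨z, h, hz, hz'⟩
        exact (hJ.mem_or_mem h1).elim hu hv }
  refine ⟨x, fun a => Quotient.inductionOn a fun t => ?_⟩
  induction t with
  | var u => exact Iff.rfl
  | top => exact ⟨fun _ => htop, fun _ => trivial⟩
  | bot => exact ⟨fun h => h.elim, fun h => h J.bot_mem⟩
  | sup s t hs ht =>
    refine (or_congr hs ht).trans ?_
    rw [← not_and_or]
    exact not_congr Order.Ideal.sup_mem_iff.symm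
  | inf s t hs ht =>
    refine (and_congr hs ht).trans ?_
    rw [← not_or]
    let s' : X.scaled := PresentedBool.mk s
    let t' : X.scaled := PresentedBool.mk t
    exact not_congr ⟨fun h => h.elim (fun h => J.lower (inf_le_left : s' ⊓ t' ≤ s') h)
      fun h => J.lower (inf_le_right : s' ⊓ t' ≤ t') h, fun h => hJ.mem_or_mem h⟩
  | compl s hs =>
    refine (not_congr hs).trans ?_
    rw [not_not]
    refine ⟨fun h h' => htop ?_, fun h => (hJ.mem_or_compl_mem).resolve_right h⟩
    rw [← sup_compl_eq_top]
    exact J.sup_mem h h'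

/-- By the prime ideal theorem, ultrafilters separate elements; this allows inequalities in `F(X)`
to be checked at ideals of `X`. -/
theorem le_iff_holds : a ≤ b ↔ ∀ x : Order.Ideal X, Holds x a → Holds x b := by
  refine ⟨fun h x ha => ha.mono h, fun h => ?_⟩
  by_contra hab
  obtain ⟨J, hJ, hbJ, haJ⟩ := DistribLattice.prime_ideal_of_disjoint_filter_ideal
    (F := Order.PFilter.principal a) (I := Order.Ideal.principal b)
    (Set.disjoint_left.2 fun c hc hc' =>
      hab ((Order.PFilter.mem_principal.1 hc).trans (Order.Ideal.mem_principal.1 hc')))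
  obtain ⟨x, hx⟩ := exists_ideal_of_isPrime hJ
  have ha : Holds x a :=
    (hx a).2 (Set.disjoint_left.1 haJ (Order.PFilter.mem_principal.2 le_rfl))
  exact (hx b).1 (h x ha) (hbJ (Order.Ideal.mem_principal.2 le_rfl))

/-- Otherwise the prime ideal complementary to the ultrafilter would contain all generators of
`F(X)^(p)`, hence `a`. -/
theorem exists_le_norm_of_holds {p : P} (ha : a ∈ X.scaled.ideal p) (hx : Holds x a) :
    ∃ v ∈ x, p ≤ X.norm v := by
  by_contra hne
  let I : Order.Ideal X.scaled :=
    { carrier := {a | ¬ Holds x a}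
      lower' := fun a b h ha hb => ha (hb.mono h)
      nonempty' := ⟨⊥, not_holds_bot x⟩
      directed' := fun a ha b hb =>
        ⟨a ⊔ b, fun h => ((holds_sup x a b).1 h).elim ha hb, le_sup_left, le_sup_right⟩ }
  have h1 : X.freeIdeal p ≤ I := X.freeIdeal_le fun u hu hux => hne ⟨u, hux, hu⟩
  exact h1 ha hx

end Holds

/-! ### Supports -/

/-- Two ideals of `X` have the same elements in `Z`. -/
def AgreeOn (Z : Set X) (x y : Order.Ideal X) : Prop := ∀ u ∈ Z, u ∈ x ↔ u ∈ y

theorem exists_finite_support (a : X.scaled) :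
    ∃ Z : Set X, Z.Finite ∧ ∀ x y, AgreeOn Z x y → (Holds x a ↔ Holds y a) := by
  refine Quotient.inductionOn a fun t => ?_
  induction t with
  | var u => exact ⟨{u}, Set.finite_singleton u, fun x y h => h u rfl⟩
  | top => exact ⟨∅, Set.finite_empty, fun _ _ _ => Iff.rfl⟩
  | bot => exact ⟨∅, Set.finite_empty, fun _ _ _ => Iff.rfl⟩
  | sup s t hs ht =>
    obtain ⟨Y, hY, h⟩ := hs
    obtain ⟨Z, hZ, h'⟩ := ht
    exact ⟨Y ∪ Z, hY.union hZ, fun x y hxy => or_congr (h x y fun u hu => hxy u (Or.inl hu))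
      (h' x y fun u hu => hxy u (Or.inr hu))⟩
  | inf s t hs ht =>
    obtain ⟨Y, hY, h⟩ := hs
    obtain ⟨Z, hZ, h'⟩ := ht
    exact ⟨Y ∪ Z, hY.union hZ, fun x y hxy => and_congr (h x y fun u hu => hxy u (Or.inl hu))
      (h' x y fun u hu => hxy u (Or.inr hu))⟩
  | compl s hs =>
    obtain ⟨Y, hY, h⟩ := hs
    exact ⟨Y, hY, fun x y hxy => not_congr (h x y hxy)⟩

open ScaledBool

theorem exists_atom (f : Chart X.scaled) (x : Order.Ideal X) : ∃ u : f.part.parts, Holds x u.1 := by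
  have h := holds_top x
  rw [← f.part.sup_parts, holds_finset_sup] at h
  obtain ⟨u, hu, hux⟩ := h
  exact ⟨⟨u, hu⟩, hux⟩

/-- The atom of a finite subalgebra that belongs to the ultrafilter given by `x`. -/
noncomputable def atom (f : Chart X.scaled) (x : Order.Ideal X) : f.part.parts :=
  (exists_atom f x).choose

theorem holds_atom (f : Chart X.scaled) (x : Order.Ideal X) : Holds x (atom f x).1 :=
  (exists_atom f x).choose_spec

theorem eq_atom {f : Chart X.scaled} {x : Order.Ideal X} {u : f.part.parts} (h : Holds x u.1) :
    u = atom f x := by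
  have h' := (holds_inf x _ _).2 ⟨h, holds_atom f x⟩
  refine f.part_unique (v := u.1 ⊓ (atom f x).1) (fun h0 => ?_) inf_le_left inf_le_right
  exact not_holds_bot x (h0 ▸ h')

theorem atom_le_atom {f g : Chart X.scaled} (h : f ≤ g) (x : Order.Ideal X) :
    (atom g x).1 ≤ (atom f x).1 := by
  obtain ⟨u, hu⟩ := Chart.exists_parent h (atom g x)
  rwa [eq_atom ((holds_atom g x).mono hu)] at hu

theorem parent_atom {f g : Chart X.scaled} (h : f ≤ g) (x : Order.Ideal X) :
    Chart.parent h (atom g x) = atom f x :=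
  (Chart.parent_eq h _ _ (atom_le_atom h x)).symm

theorem val_atom_le_val_atom {f g : Chart X.scaled} (h : f ≤ g) (x : Order.Ideal X) :
    f.val (atom f x) ≤ g.val (atom g x) := h.2 _ _ (atom_le_atom h x)

theorem val_atom_le (f : Chart X.scaled) {x : Order.Ideal X} {p : P}
    (hp : p ∈ upperBounds (X.norm '' (x : Set X))) : f.val (atom f x) ≤ p := by
  obtain ⟨v, hv, h⟩ := exists_le_norm_of_holds x (f.mem _) (holds_atom f x)
  exact h.trans (hp ⟨v, hv, rfl⟩)

/-- The finite subalgebra underlying `f` is determined by the generators in `Z`. -/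
def Supports (Z : Set X) (f : Chart X.scaled) : Prop :=
  ∀ x y, AgreeOn Z x y → atom f x = atom f y

theorem Supports.of_le {Z : Set X} {f g : Chart X.scaled} (hg : Supports Z g) (h : f ≤ g) :
    Supports Z f := fun x y hxy => by
  rw [← parent_atom h x, ← parent_atom h y, hg x y hxy]

theorem Supports.mono {Y Z : Set X} {f : Chart X.scaled} (hf : Supports Y f) (h : Y ⊆ Z) :
    Supports Z f := fun x y hxy => hf x y fun u hu => hxy u (h hu)

theorem exists_finite_supports (f : Chart X.scaled) : ∃ Z : Set X, Z.Finite ∧ Supports Z f := by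
  choose Z hZ h using exists_finite_support (X := X)
  refine ⟨⋃ u : f.part.parts, Z u.1, Set.finite_iUnion fun u => hZ _, fun x y hxy => ?_⟩
  refine eq_atom ((h _ x y fun u hu => hxy u ?_).1 (holds_atom f x))
  exact Set.mem_iUnion.2 ⟨_, hu⟩

/-- If `Z` is finite and `▽`-closed, there is a largest element of `Σ_{F(X)}` supported by `Z`. -/
theorem exists_isGreatest_supports {Z : Set X} (hZ : Z.Finite) (hZc : NablaClosed Z) :
    ∃ g, IsGreatest {f : Chart X.scaled | Supports Z f} g := by
  classical
  -- For `z ∈ Z`, the element `a z` holds at exactly those ideals whose trace on `Z` has greatest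
  -- element `z`. As `Z` is finite and `▽`-closed, every ideal has such a trace, so the `a z` form a
  -- partition of the unit.
  let a : X → X.scaled := fun z =>
    X.gen z ⊓ (hZ.toFinset.filter (z < ·)).inf fun v => (X.gen v : X.scaled)ᶜ
  have ha : ∀ (z : X) (y : Order.Ideal X), Holds y (a z) ↔ z ∈ y ∧ ∀ v ∈ Z, z < v → v ∉ y := by
    intro z y
    refine (holds_inf y _ _).trans (and_congr Iff.rfl ((holds_finset_inf y _ _).trans ?_))
    simp only [Finset.mem_filter, Set.Finite.mem_toFinset, and_imp]
    exact forall₃_congr fun _ _ _ => Iff.rfl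
  have ha_mem : ∀ z ∈ Z, ∀ y, Holds y (a z) → ∀ v ∈ Z, v ∈ y ↔ v ≤ z := by
    intro z hz y hy v hv
    obtain ⟨hzy, hmax⟩ := (ha z y).1 hy
    refine ⟨fun hvy => ?_, fun h => y.lower h hzy⟩
    obtain ⟨t, hty, hvt, hzt⟩ := y.directed v hvy z hzy
    have ht : t ∈ upperBounds ({v, z} : Set X) := by
      rintro _ (rfl | rfl)
      · exact hvt
      · exact hzt
    obtain ⟨b, hb, hbt⟩ := upperBounds_subset_of_pjs X.pjs (Or.inr ⟨v, z, rfl⟩) ht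
    have hbZ : b ∈ Z := hZc {v, z} (by simp) (by
      rintro _ (rfl | rfl)
      · exact hv
      · exact hz) hb
    have hzb : z ≤ b := hb.1 (by simp)
    have hvb : v ≤ b := hb.1 (by simp)
    rcases hzb.eq_or_lt with rfl | h
    · exact hvb
    · exact absurd (y.lower hbt hty) (hmax b hbZ h)
  have ha_self : ∀ z, Holds (Order.Ideal.principal z) (a z) := fun z =>
    (ha z _).2 ⟨le_rfl, fun v _ hzv hv => (lt_of_lt_of_le hzv hv).false⟩
  have ha_unique : ∀ z ∈ Z, ∀ z' ∈ Z, ∀ y, Holds y (a z) → Holds y (a z') → z = z' := by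
    intro z hz z' hz' y h h'
    exact le_antisymm ((ha_mem z' hz' y h' z hz).1 ((ha z y).1 h).1)
      ((ha_mem z hz y h z' hz').1 ((ha z' y).1 h').1)
  have ha_exists : ∀ y : Order.Ideal X, ∃ z ∈ Z, Holds y (a z) := by
    intro y
    obtain ⟨t, ht⟩ := y.nonempty
    obtain ⟨b, hb, hbt⟩ := upperBounds_subset_of_pjs X.pjs (Y := (∅ : Set X)) (Or.inl rfl)
      (a := t) (by simp)
    have hbZ : b ∈ Z := hZc ∅ Set.finite_empty (Set.empty_subset _) hb
    obtain ⟨z, hz⟩ := (hZ.inter_of_left (y : Set X)).exists_maximal ⟨b, hbZ, y.lower hbt ht⟩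
    exact ⟨z, hz.1.1, (ha z y).2 ⟨hz.1.2, fun v hv hzv hvy => hz.not_gt ⟨hv, hvy⟩ hzv⟩⟩
  let π : Finpartition (⊤ : X.scaled) :=
    { parts := hZ.toFinset.image a
      supIndep := by
        rw [Finset.supIndep_iff_pairwiseDisjoint]
        intro c hc d hd hcd
        obtain ⟨z, hz, rfl⟩ := Finset.mem_image.1 (Finset.mem_coe.1 hc)
        obtain ⟨z', hz', rfl⟩ := Finset.mem_image.1 (Finset.mem_coe.1 hd)
        rw [Set.Finite.mem_toFinset] at hz hz'
        refine disjoint_iff_inf_le.2 (le_iff_holds.2 fun y hy => ?_)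
        have hy' := (holds_inf y _ _).1 hy
        exact absurd (congrArg a (ha_unique z hz z' hz' y hy'.1 hy'.2)) hcd
      sup_parts := by
        refine top_le_iff.1 (le_iff_holds.2 fun y _ => (holds_finset_sup y _).2 ?_)
        obtain ⟨z, hz, h⟩ := ha_exists y
        exact ⟨a z, Finset.mem_image_of_mem a (hZ.mem_toFinset.2 hz), h⟩
      bot_notMem := fun h => by
        obtain ⟨z, -, hz⟩ := Finset.mem_image.1 h
        exact not_holds_bot (Order.Ideal.principal z) (hz ▸ ha_self z) }
  have hπ : ∀ c : π.parts, ∃ z ∈ Z, a z = c.1 := fun c => by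
    obtain ⟨z, hz, h⟩ := Finset.mem_image.1 c.2
    exact ⟨z, hZ.mem_toFinset.1 hz, h⟩
  choose z hzZ hz using hπ
  let g : Chart X.scaled :=
    { part := π
      val := fun c => X.norm (z c)
      mem := fun c => by
        rw [← hz c]
        exact (X.freeIdeal _).lower inf_le_left (X.gen_mem le_rfl) }
  refine ⟨g, fun x y hxy => ?_, fun f hf => ?_⟩
  · refine eq_atom (f := g) ?_
    have h := holds_atom g x
    rw [← hz (atom g x)] at h ⊢
    rw [ha] at h ⊢
    exact ⟨(hxy _ (hzZ _)).1 h.1, fun v hv hlt hvy => h.2 v hv hlt ((hxy v hv).2 hvy)⟩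
  · have hle : ∀ c : π.parts, c.1 ≤ (atom f (Order.Ideal.principal (z c))).1 := by
      intro c
      refine le_iff_holds.2 fun y hy => ?_
      rw [← hz c] at hy
      have h : atom f (Order.Ideal.principal (z c)) = atom f y :=
        hf _ _ fun v hv => (ha_mem _ (hzZ c) y hy v hv).symm
      rw [h]
      exact holds_atom f y
    refine ⟨fun c hc => ⟨_, (atom f (Order.Ideal.principal (z ⟨c, hc⟩))).2, hle ⟨c, hc⟩⟩,
      fun u c hcu => ?_⟩
    rw [f.part_unique (g.part.ne_bot c.2) hcu (hle c)]
    -- The atom of `f` above `a z` is the one chosen by the principal ideal of `z`, whose norms are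
    -- bounded by `∂ z`. So `∂ z` is the largest value needed.
    refine val_atom_le f ?_
    rintro _ ⟨v, hv, rfl⟩
    exact X.norm.monotone hv

/-! ### Continuous coverings of `Σ_{F(X)}` -/

theorem nablaClosed_nablaClosure (Y : Set X) : NablaClosed (nablaClosure Y) :=
  fun Z hZ hZY _ ha W hW => hW.1 Z hZ (fun _ hz => hZY hz W hW) ha

theorem subset_nablaClosure (Y : Set X) : Y ⊆ nablaClosure Y := fun _ ha _ hW => hW.2 ha

theorem nablaClosure_mono {Y Z : Set X} (h : Y ⊆ Z) : nablaClosure Y ⊆ nablaClosure Z :=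
  fun _ ha W hW => ha W ⟨hW.1, h.trans hW.2⟩

/-- Pieces consist of the charts supported by the finite set `nablaClosure Y`; each has a greatest
element, hence is directed. -/
theorem exists_continuousCovering_of_isSupported (hX : IsSupported X) :
    ∃ T : ContinuousCovering ℵ₀ (Chart X.scaled),
      ∀ Y, ∃ Z : Set X, #Z < ℵ₀ ∧ ∀ f ∈ T.piece Y, Supports Z f := by
  have hfin : ∀ Y : SmallSubsets X ℵ₀, (nablaClosure Y.1).Finite := fun Y =>
    hX.2 _ (lt_aleph0_iff_set_finite.1 Y.2)
  choose g hg using fun Y : SmallSubsets X ℵ₀ =>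
    exists_isGreatest_supports (hfin Y) (nablaClosed_nablaClosure _)
  refine ⟨{
    index := X
    piece := fun Y => {f | Supports (nablaClosure Y.1) f}
    mono := fun Y Z h f hf => Supports.mono hf (nablaClosure_mono h)
    nonempty := fun Y => ⟨g Y, (hg Y).1⟩
    directed := fun Y f hf f' hf' => ⟨g Y, (hg Y).1, (hg Y).2 hf, (hg Y).2 hf'⟩
    cover := fun f => by
      obtain ⟨Z, hZ, hf⟩ := exists_finite_supports f
      exact ⟨⟨Z, lt_aleph0_iff_set_finite.2 hZ⟩, hf.mono (subset_nablaClosure Z)⟩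
    continuous := fun D p hne hD hp f hf => ⟨p, ?_, hf⟩ },
    fun Y => ⟨_, lt_aleph0_iff_set_finite.2 (hfin Y), fun f hf => hf⟩⟩
  -- All members of `D` are subsets of the finite set `p`, so the directed set `D` is finite and its
  -- supremum `p` belongs to it.
  have hDfin : D.Finite := by
    refine Set.Finite.of_finite_image (f := Subtype.val)
      ((lt_aleph0_iff_set_finite.1 p.2).finite_subsets.subset ?_) Subtype.val_injective.injOn
    rintro _ ⟨Y, hY, rfl⟩
    exact hp.1 hY
  obtain ⟨Y, hY⟩ := hDfin.exists_maximal hne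
  have hYub : Y ∈ upperBounds D := fun Z hZ => by
    obtain ⟨W, hW, hYW, hZW⟩ := hD Y hY.1 Z hZ
    exact hZW.trans (hY.2 hW hYW)
  rw [hp.unique ⟨hYub, fun W hW => hW hY.1⟩]
  exact hY.1

theorem IsLifter.exists_continuousCovering {lam : Cardinal.{w}} (hlam : ℵ₀ ≤ lam)
    {XX : Set X.SharpIdeal} (hX : IsLifter lam X XX) :
    ∃ T : ContinuousCovering lam (Chart X.scaled),
      ∀ Y, ∃ Z : Set X, #Z < lam ∧ ∀ f ∈ T.piece Y, Supports Z f := by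
  rcases hlam.eq_or_lt with rfl | h
  · exact exists_continuousCovering_of_isSupported (hX.supported rfl)
  · obtain ⟨T, hT⟩ := exists_continuousCovering_of_aleph0_lt h (Chart X.scaled)
    choose Z hZ hZs using exists_finite_supports (X := X)
    refine ⟨T, fun Y => ?_⟩
    obtain ⟨U, hU, hUT⟩ := hT Y
    -- A support of a chart supports every smaller chart, so the finite supports of a cofinal set of
    -- fewer than `lam` charts suffice.
    refine ⟨⋃ g : U, Z g, (mk_iUnion_le _).trans_lt (mul_lt_of_lt hlam hU ?_), fun f hf => ?_⟩
    · exact lt_of_le_of_lt (ciSup_le' fun g => (lt_aleph0_iff_set_finite.2 (hZ _)).le) h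
    · obtain ⟨g, hg, hfg⟩ := hUT f hf
      exact ((hZs g).mono (Set.subset_iUnion (fun g : U => Z g) ⟨g, hg⟩)).of_le hfg

end NormCovering

/-! ### Evaluations of the condensate as extended projections -/

theorem isProjection_pi {C : Type u} [Category.{v} C] {ι : Type w} [Finite ι] (Z : ι → C)
    [HasProduct Z] (i : ι) : IsProjection (Pi.π Z i) := by
  -- `IsProjection` requires an index set in the lowest universe, hence the reindexing by `Fin n`.
  obtain ⟨n, ⟨e⟩⟩ := Finite.exists_equiv_fin ι
  obtain ⟨k, rfl⟩ := e.symm.surjective i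
  let c : Fan fun k : Fin n => Z (e.symm k) := Fan.mk (∏ᶜ Z) fun k => Pi.π Z (e.symm k)
  have hc : IsLimit c := Fan.IsLimit.mk c
    (fun s => Pi.lift fun i => s.proj (e i) ≫ eqToHom (by rw [e.symm_apply_apply]))
    (fun s k => by
      have h : ∀ (l : Fin n) (hl : l = k) (h' : Z (e.symm l) = Z (e.symm k)),
          s.proj l ≫ eqToHom h' = s.proj k := by
        rintro l rfl h'
        exact Category.comp_id _
      exact (Pi.lift_π _ _).trans (h _ (e.apply_symm_apply k) _))
    (fun s m hm => Pi.hom_ext (f := Z) m (Pi.lift _) fun i => by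
      rw [Pi.lift_π]
      obtain ⟨k, rfl⟩ := e.symm.surjective i
      have h : ∀ (l : Fin n) (hl : l = k) (h' : Z (e.symm l) = Z (e.symm k)),
          m ≫ Pi.π Z (e.symm k) = s.proj l ≫ eqToHom h' := by
        rintro l rfl h'
        exact (hm l).trans (Category.comp_id _).symm
      exact h _ (e.apply_symm_apply k) _)
  exact IsProjection.proj _ c hc k

namespace NormCovering

open ScaledBool

variable {P : Type w} [PartialOrder P] {X : NormCovering P}

section Evaluation

variable {C : Type u} [Category.{v} C] {S : P ⥤ C} (hS : HasTensor X.scaled S)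

/-- The canonical projections of the objects of `tensorDiagram`. -/
noncomputable def tensorπ (f : Chart X.scaled) (u : f.part.parts) :
    (tensorDiagram hS).obj f ⟶ S.obj (f.val u) :=
  haveI := hS f
  Pi.π (fun u : f.part.parts => S.obj (f.val u)) u

theorem isProjection_tensorπ (f : Chart X.scaled) (u : f.part.parts) :
    IsProjection (tensorπ hS f u) :=
  haveI := hS f
  isProjection_pi _ u

theorem tensorDiagram_map_π {f g : Chart X.scaled} (h : f ⟶ g) (v : g.part.parts) :
    (tensorDiagram hS).map h ≫ tensorπ hS g v =
      tensorπ hS f (Chart.parent (leOfHom h) v) ≫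
        S.map (homOfLE (Chart.val_parent_le (leOfHom h) v)) :=
  haveI := hS f
  haveI := hS g
  Pi.lift_π _ v

theorem tensorπ_map_congr {f : Chart X.scaled} {u u' : f.part.parts} (h : u = u') {p : P}
    (hu : f.val u ≤ p) (hu' : f.val u' ≤ p) :
    tensorπ hS f u ≫ S.map (homOfLE hu) = tensorπ hS f u' ≫ S.map (homOfLE hu') := by
  subst h
  rfl

variable (x : Order.Ideal X) {p : P} (hp : p ∈ upperBounds (X.norm '' (x : Set X)))

/-- The component at `f` of the evaluation of `F(X) ⊗ S` at `x`. -/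
noncomputable def evalAt (f : Chart X.scaled) : (tensorDiagram hS).obj f ⟶ S.obj p :=
  tensorπ hS f (atom f x) ≫ S.map (homOfLE (val_atom_le f hp))

theorem tensorDiagram_map_evalAt {f g : Chart X.scaled} (h : f ⟶ g) :
    (tensorDiagram hS).map h ≫ evalAt hS x hp g = evalAt hS x hp f := by
  rw [evalAt, ← Category.assoc, tensorDiagram_map_π, Category.assoc, ← S.map_comp, homOfLE_comp]
  exact tensorπ_map_congr hS (parent_atom _ x) _ _

end Evaluation

variable {C : Type u} [Category.{v} C] (hC : HasSmallDirectedColimits.{w} C)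
  (hP : HasBinaryProducts C) (S : P ⥤ C)

/-- The limiting morphisms of the condensate `F(X) ⊗ S`. -/
noncomputable def condensateCocone : Cocone (tensorDiagram (hasTensor X.scaled hP S)) :=
  haveI := hC (Chart X.scaled)
  colimit.cocone _

/-- The condensate is a colimit. -/
noncomputable def isColimitCondensateCocone :
    IsColimit (condensateCocone (X := X) hC hP S) :=
  haveI := hC (Chart X.scaled)
  colimit.isColimit _

/-- For an ideal `x` of `X` whose elements have norm at most `p`, the morphism `F(X) ⊗ S ⟶ S p`
induced by the ultrafilter of `F(X)` associated with `x`. -/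
noncomputable def evaluation (x : Order.Ideal X) {p : P}
    (hp : p ∈ upperBounds (X.norm '' (x : Set X))) : condensate hC hP X.scaled S ⟶ S.obj p :=
  (isColimitCondensateCocone hC hP S).desc
    { pt := S.obj p
      ι :=
        { app := evalAt (hasTensor X.scaled hP S) x hp
          naturality := fun _ _ h =>
            (tensorDiagram_map_evalAt _ x hp h).trans (Category.comp_id _).symm } }

/-- The limiting morphism from the object of `tensorDiagram` at `f` to the condensate. -/
noncomputable def condensateι (f : Chart X.scaled) :
    (tensorDiagram (hasTensor X.scaled hP S)).obj f ⟶ condensate hC hP X.scaled S :=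
  (condensateCocone hC hP S).ι.app f

theorem condensateι_evaluation (x : Order.Ideal X) {p : P}
    (hp : p ∈ upperBounds (X.norm '' (x : Set X))) (f : Chart X.scaled) :
    condensateι hC hP S f ≫ evaluation hC hP S x hp = evalAt _ x hp f :=
  (isColimitCondensateCocone hC hP S).fac _ f

theorem condensate_hom_ext {L : C} {a b : condensate hC hP X.scaled S ⟶ L}
    (h : ∀ f, condensateι hC hP S f ≫ a = condensateι hC hP S f ≫ b) : a = b :=
  (isColimitCondensateCocone hC hP S).hom_ext h

theorem evaluation_map (x : Order.Ideal X) {p q : P}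
    (hp : p ∈ upperBounds (X.norm '' (x : Set X))) (hq : q ∈ upperBounds (X.norm '' (x : Set X)))
    (h : p ⟶ q) : evaluation hC hP S x hp ≫ S.map h = evaluation hC hP S x hq := by
  refine condensate_hom_ext hC hP S fun f => ?_
  rw [← Category.assoc, condensateι_evaluation, condensateι_evaluation, evalAt, evalAt,
    Category.assoc, ← S.map_comp]
  rfl

/-- This is where sharpness enters: some `v ∈ x` has norm exactly `p`, and its generator `e` lies in
`F(X)^(p)`. -/
theorem exists_chart_val_atom_eq {x : Order.Ideal X} {p : P}
    (hp : IsGreatest (X.norm '' (x : Set X)) p) (f : Chart X.scaled) :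
    ∃ g : Chart X.scaled, g.val (atom g x) = p ∧ f ≤ g := by
  classical
  obtain ⟨⟨v, hv, hvp⟩, hpx⟩ := hp
  let e : X.scaled := X.gen v
  have hve : Holds x e := hv
  have he : e ∈ X.scaled.ideal p := X.gen_mem hvp.ge
  -- Ideals of index other than `p` are cut down to the complement of `e`. They still generate the
  -- unit ideal, but an atom holding at `x` meets `e` and so can only receive the value `p`.
  let I : P → Order.Ideal X.scaled := fun r =>
    if r = p then X.scaled.ideal p else X.scaled.ideal r ⊓ Order.Ideal.principal eᶜ
  have hIp : I p = X.scaled.ideal p := if_pos rfl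
  have hI : ∀ r, I r ≤ X.scaled.ideal r := fun r => by
    by_cases h : r = p
    · rw [h, hIp]
    · exact (if_neg h : I r = _).le.trans inf_le_left
  have htop : (⊤ : X.scaled) ∈ ⨆ r : (Set.univ : Set P), I r := by
    have h1 : (⊤ : Order.Ideal X.scaled) ≤ ⨆ r : (Set.univ : Set P), I r := by
      rw [← X.scaled.iSup_ideal]
      refine iSup_le fun r a ha => ?_
      by_cases h : r = p
      · refine (le_iSup (fun r : (Set.univ : Set P) => I r) ⟨p, trivial⟩) ?_
        change a ∈ I p
        rw [hIp, ← h]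
        exact ha
      · rw [show a = a ⊓ e ⊔ a ⊓ eᶜ by rw [← inf_sup_left, sup_compl_eq_top, inf_top_eq]]
        refine Order.Ideal.sup_mem ?_ ?_
        · refine (le_iSup (fun r : (Set.univ : Set P) => I r) ⟨p, trivial⟩) ?_
          change a ⊓ e ∈ I p
          rw [hIp]
          exact (X.scaled.ideal p).lower inf_le_right he
        · refine (le_iSup (fun r : (Set.univ : Set P) => I r) ⟨r, trivial⟩) ?_
          have h2 : I r = _ := if_neg h
          change a ⊓ eᶜ ∈ I r
          rw [h2]
          exact ⟨(X.scaled.ideal r).lower inf_le_left ha, Order.Ideal.mem_principal.2 inf_le_right⟩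
    exact h1 trivial
  obtain ⟨π, hπ⟩ := Chart.exists_finpartition I Set.univ _ htop
  choose r _ hr using hπ
  let k : Chart X.scaled := ⟨π, fun u => r u.1 u.2, fun u => hI _ (hr u.1 u.2)⟩
  have hk : k.val (atom k x) = p := by
    by_contra h
    have h1 : (atom k x).1 ∈ I (k.val (atom k x)) := hr _ (atom k x).2
    have h2 : I (k.val (atom k x)) = _ := if_neg h
    rw [h2] at h1
    exact (holds_compl x e).1 ((holds_atom k x).mono (Order.Ideal.mem_principal.1 h1.2)) hve
  obtain ⟨g, hfg, hkg⟩ := exists_ge_ge f k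
  exact ⟨g, le_antisymm (val_atom_le g hpx) (hk ▸ val_atom_le_val_atom hkg x), hfg⟩

/-- On the cofinal set `T` the chosen atom has value `p`, so the targets of the projections form a
diagram of copies of `S p` with colimit `S p`. -/
theorem isExtendedProjection_evaluation {x : Order.Ideal X} {p : P}
    (hp : IsGreatest (X.norm '' (x : Set X)) p) :
    IsExtendedProjection.{w} (evaluation hC hP S x hp.2) := by
  let T : Set (Chart X.scaled) := {f | f.val (atom f x) = p}
  have hT : ∀ f, ∃ g ∈ T, f ≤ g := exists_chart_val_atom_eq hp
  have := final_inclusion hT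
  have := isDirectedOrder_of_cofinal hT
  have : Nonempty {f // f ∈ T} :=
    let ⟨g, hg, _⟩ := hT (Classical.arbitrary _)
    ⟨⟨g, hg⟩⟩
  have hS := hasTensor X.scaled hP S
  have hmono : Monotone fun f : {f // f ∈ T} => f.1.val (atom f.1 x) := fun f g h =>
    val_atom_le_val_atom h x
  -- The objects of `G` are equal to `S p` only propositionally, so the colimit property is verified
  -- through the morphisms given by the two inequalities.
  let G : {f // f ∈ T} ⥤ C := hmono.functor ⋙ S
  let d : Cocone G :=
    { pt := S.obj p
      ι :=
        { app := fun f => S.map (homOfLE f.2.le)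
          naturality := fun f g h => by
            refine Eq.trans ?_ (Category.comp_id _).symm
            exact (S.map_comp _ _).symm } }
  have hd : Nonempty (IsColimit d) := by
    refine nonempty_isColimit d (L := S.obj p) (fun f => S.map (homOfLE f.2.le)) rfl
      (fun f => (Category.comp_id _).symm) (fun L' a b h => ?_) fun L' l hl => ?_
    · obtain ⟨f⟩ := this
      have h1 : ∀ c : S.obj p ⟶ L', S.map (homOfLE f.2.ge) ≫ S.map (homOfLE f.2.le) ≫ c = c := by
        intro c
        rw [← Category.assoc, ← S.map_comp]
        exact (congrArg (· ≫ c) (S.map_id p)).trans (Category.id_comp c)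
      rw [← h1 a, ← h1 b]
      exact congrArg _ (h f)
    · obtain ⟨f⟩ := this
      refine ⟨S.map (homOfLE f.2.ge) ≫ l f, fun g => ?_⟩
      obtain ⟨k, hfk, hgk⟩ := exists_ge_ge f g
      rw [← hl g k hgk, ← hl f k hfk]
      have h1 : ∀ {p₁ p₂ p₃ p₄ : P} (h₁ : p₁ ≤ p₂) (h₂ : p₂ ≤ p₃) (h₃ : p₃ ≤ p₄)
          (m : S.obj p₄ ⟶ L'),
          S.map (homOfLE h₁) ≫ S.map (homOfLE h₂) ≫ S.map (homOfLE h₃) ≫ m =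
            S.map (homOfLE (h₁.trans (h₂.trans h₃))) ≫ m := by
        intro _ _ _ _ h₁ h₂ h₃ m
        rw [← Category.assoc, ← Category.assoc, ← S.map_comp, ← S.map_comp]
        rfl
      exact h1 g.2.le f.2.ge (hmono hfk) (l k)
  refine IsExtendedProjection.mk {f // f ∈ T} (inclusion T ⋙ tensorDiagram hS) G
    ((condensateCocone hC hP S).whisker (inclusion T))
    ((Functor.Final.isColimitWhiskerEquiv _ _).symm (isColimitCondensateCocone hC hP S)) d hd.some
    { app := fun f => tensorπ hS f.1 (atom f.1 x)
      naturality := fun f g h => ?_ } (fun f => isProjection_tensorπ hS _ _) _ fun f => ?_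
  · refine (tensorDiagram_map_π hS ((inclusion T).map h) _).trans ?_
    exact tensorπ_map_congr hS (parent_atom _ x) _ _
  · exact condensateι_evaluation hC hP S x hp.2 f.1

end NormCovering

/-- The extension of a diagram over `B` by the object `B` itself, put at the top. -/
def extendTop {ℬ : Type u₂} [Category.{v₂} ℬ] {Q : Type w} [PartialOrder Q] (F : Q ⥤ ℬ) {B : ℬ}
    (γ : ∀ x, F.obj x ⟶ B) (hγ : ∀ {x y : Q} (h : x ⟶ y), F.map h ≫ γ y = γ x) :
    WithTop Q ⥤ ℬ where
  obj
    | none => B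
    | some x => F.obj x
  map {x y} h := match x, y, h with
    | none, none, _ => 𝟙 B
    | none, some y, h => (WithTop.not_top_le_coe y (leOfHom h)).elim
    | some x, none, _ => γ x
    | some _, some _, h => F.map (homOfLE (WithTop.coe_le_coe.1 (leOfHom h)))
  map_id
    | none => rfl
    | some x => F.map_id x
  map_comp {x y z} f g := match x, y, z, f, g with
    | none, none, none, _, _ => (Category.id_comp _).symm
    | none, some y, _, f, _ => (WithTop.not_top_le_coe y (leOfHom f)).elim
    | _, none, some z, _, g => (WithTop.not_top_le_coe z (leOfHom g)).elim
    | some _, none, none, _, _ => (Category.comp_id _).symm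
    | some _, some _, none, _, _ => (hγ _).symm
    | some _, some _, some _, _, _ => F.map_comp _ _

/-- The morphisms to the top object of `extendTop`. -/
def extendTopLeg {ℬ : Type u₂} [Category.{v₂} ℬ] {Q : Type w} [PartialOrder Q] (F : Q ⥤ ℬ) {B : ℬ}
    (γ : ∀ x, F.obj x ⟶ B) (hγ : ∀ {x y : Q} (h : x ⟶ y), F.map h ≫ γ y = γ x) (t : WithTop Q) :
    (extendTop F γ hγ).obj t ⟶ B :=
  (extendTop F γ hγ).map (homOfLE (le_top : t ≤ ⊤))

/-! ### Lifting projectable larders, and the three cases for buttresses -/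

namespace LarderData

variable {𝒜 : Type u₁} [Category.{v₁} 𝒜] {ℬ : Type u₂} [Category.{v₂} ℬ]
  {𝒮 : Type u₃} [Category.{v₃} 𝒮] {Λ : LarderData 𝒜 ℬ 𝒮}

/-- The witnesses lift each conjugate of `Φ (A f)` by the isomorphisms `ε` to a morphism of `ℬ`;
since the `a p` are epimorphisms, these lifts compose functorially. -/
theorem IsProjectable.exists_lifting (hΛ : Λ.IsProjectable) {P : Type w} [PartialOrder P]
    {A : P ⥤ 𝒜} {F : P ⥤ ℬ} (χ : F ⋙ Λ.Ψ ⟶ A ⋙ Λ.Φ) (hχ : ∀ p, Λ.double (χ.app p)) :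
    ∃ F' : P ⥤ ℬ, Nonempty (F' ⋙ Λ.Ψ ≅ A ⋙ Λ.Φ) ∧ ∃ τ : F ⟶ F', ∀ p, Epi (τ.app p) := by
  choose c a ε h using fun p => hΛ (F.obj p) (Λ.Φ.obj (A.obj p)) (χ.app p) (hχ p)
  have hepi := fun p => (h p).epi
  have hiso := fun p => (h p).isIso
  have hfac : ∀ p, Λ.Ψ.map (a p) ≫ ε p = χ.app p := fun p => (h p).fac
  have hnat : ∀ {p q : P} (f : p ⟶ q),
      Λ.Ψ.map (F.map f) ≫ χ.app q = χ.app p ≫ Λ.Φ.map (A.map f) := fun f => χ.naturality f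
  have key : ∀ {p q : P} (f : p ⟶ q), ∃ g : c p ⟶ c q, F.map f ≫ a q = a p ≫ g ∧
      ε p ≫ Λ.Φ.map (A.map f) ≫ inv (ε q) = Λ.Ψ.map g := by
    intro p q f
    refine (h p).lift _ _ _ ?_
    rw [Λ.Ψ.map_comp, ← Category.assoc, hfac, ← Category.assoc, ← hnat, ← hfac q]
    simp
  choose g hg hg' using @key
  refine ⟨{
    obj := c
    map := g
    map_id := fun p => by
      rw [← cancel_epi (a p), ← hg, F.map_id, Category.id_comp, Category.comp_id]
    map_comp := fun {p q r} f f' => by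
      rw [← cancel_epi (a p), ← hg, F.map_comp, Category.assoc, hg, ← Category.assoc, hg,
        Category.assoc] },
    ⟨NatIso.ofComponents (fun p => asIso (ε p)) fun {p q} f => ?_⟩,
    { app := a
      naturality := fun p q f => hg f }, hepi⟩
  change Λ.Ψ.map (g f) ≫ ε q = ε p ≫ Λ.Φ.map (A.map f)
  rw [← hg']
  simp

open NormCovering in
theorem IsLarderAt.exists_buttress {lam mu : Cardinal.{w}} (hmu : ℵ₀ ≤ mu) {B : ℬ}
    (hΛ : Λ.IsLarderAt lam mu B) {P : Type w} [PartialOrder P] {X : NormCovering P}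
    {XX : Set X.SharpIdeal} (hX : IsLifter lam X XX)
    (hcase :
      (mu = ℵ₀ ∧ ∀ x ∈ nonMaximal XX, {y | y ∈ nonMaximal XX ∧ y ≤ x}.Finite) ∨
      (mu = lam.ord.cof ∧ (nonMaximal XX).IsWF) ∨
      (mu = lam.ord.cof ∧ Λ.IsStrong mu))
    (A : {x // x ∈ nonMaximal XX} → 𝒜) (hA : ∀ x, Λ.smallA (A x))
    (ψ : ∀ x, Λ.Ψ.obj B ⟶ Λ.Φ.obj (A x)) (hψ : ∀ x, Λ.double (ψ x)) :
    Nonempty (Λ.Buttress ψ) := by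
  have hlower : ∀ x : {x // x ∈ nonMaximal XX},
      #{y : {x // x ∈ nonMaximal XX} // y ≤ x} < lam.ord.cof := fun x => by
    refine lt_of_le_of_lt ?_ (hX.lower_small x.1 x.2)
    exact mk_le_of_injective
      (f := fun y => (⟨y.1.1, y.1.2.1, y.2⟩ : {y : X.SharpIdeal // y ∈ XX ∧ y ≤ x.1}))
      fun y z h => Subtype.ext (Subtype.ext (Subtype.mk.inj h))
  rcases hcase with ⟨rfl, hfin⟩ | ⟨rfl, hwf⟩ | ⟨rfl, hstr⟩
  · have hIic : ∀ x : {x // x ∈ nonMaximal XX}, (Set.Iic x).Finite := fun x => by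
      refine Set.Finite.of_finite_image (f := Subtype.val) ((hfin x.1 x.2).subset ?_)
        Subtype.val_injective.injOn
      rintro _ ⟨y, hy, rfl⟩
      exact ⟨y.2, hy⟩
    have : WellFoundedLT {x // x ∈ nonMaximal XX} := by
      refine ⟨Subrelation.wf (r := InvImage (· < ·) fun x => (Set.Iic x).ncard) ?_
        (InvImage.wf _ wellFounded_lt)⟩
      intro x y h
      exact Set.ncard_lt_ncard (Set.Iic_ssubset_Iic.2 h) (hIic y)
    exact hΛ.ls.nonempty_buttress (fun x => lt_aleph0_iff_set_finite.2
      ((hIic x).subset fun y hy => le_of_lt hy)) A hA ψ hψ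
  · have : WellFoundedLT {x // x ∈ nonMaximal XX} := ⟨hwf⟩
    exact hΛ.ls.nonempty_buttress (fun x => lt_of_le_of_lt
      (mk_le_mk_of_subset (s := Set.Iio x) (t := Set.Iic x) fun y hy => le_of_lt hy)
      (hlower x)) A hA ψ hψ
  · exact hstr.nonempty_buttress hmu hΛ.ls hlower A hA ψ hψ

end LarderData

/-! ### Small supports of morphisms to the condensate -/

namespace NormCovering

variable {P : Type w} [PartialOrder P] {X : NormCovering P}

theorem SharpIdeal.isGreatest_norm (x : X.SharpIdeal) :
    IsGreatest (X.norm '' (x.1 : Set X)) x.norm := x.2.choose_spec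

/-- Morphisms to `Φ (F(X) ⊗ A)` with weakly presented source have small support. -/
theorem IsLifter.exists_support {𝒜 : Type u₁} [Category.{v₁} 𝒜] {𝒮 : Type u₃} [Category.{v₃} 𝒮]
    {lam : Cardinal.{w}} (hlam : ℵ₀ ≤ lam) {XX : Set X.SharpIdeal} (hX : IsLifter lam X XX)
    (hC : HasSmallDirectedColimits.{w} 𝒜) (hP : HasBinaryProducts 𝒜) {Φ : 𝒜 ⥤ 𝒮}
    (hΦ : PreservesSmallDirectedColimits.{w} Φ) (A : P ⥤ 𝒜) {S : 𝒮}
    (hS : IsWeaklyPresented lam S) (f : S ⟶ Φ.obj (condensate hC hP X.scaled A)) :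
    ∃ Z : Set X, #Z < lam ∧ ∀ (x y : Order.Ideal X) (p : P)
      (hx : p ∈ upperBounds (X.norm '' (x : Set X))) (hy : p ∈ upperBounds (X.norm '' (y : Set X))),
      AgreeOn Z x y →
        f ≫ Φ.map (evaluation hC hP A x hx) = f ≫ Φ.map (evaluation hC hP A y hy) := by
  obtain ⟨T, hT⟩ := hX.exists_continuousCovering hlam
  obtain ⟨Y, L, ι, (l : L ⟶ condensate hC hP X.scaled A), g, hext,
    (hl : ∀ j hj, ι j hj ≫ l = condensateι hC hP A j), (hg : g ≫ Φ.map l = f)⟩ :=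
    exists_factorization hlam hC hΦ T _ (isColimitCondensateCocone hC hP A) hS f
  obtain ⟨Z, hZ, hZT⟩ := hT Y
  refine ⟨Z, hZ, fun x y p hx hy hxy => ?_⟩
  have h1 : l ≫ evaluation hC hP A x hx = l ≫ evaluation hC hP A y hy := by
    refine hext _ _ _ fun j hj => ?_
    have h3 : ∀ (z : Order.Ideal X) (hz : p ∈ upperBounds (X.norm '' (z : Set X))),
        ι j hj ≫ l ≫ evaluation hC hP A z hz = evalAt _ z hz j := fun z hz => by
      rw [← condensateι_evaluation hC hP A z hz, ← hl j hj, Category.assoc]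
    refine (h3 x hx).trans (Eq.trans ?_ (h3 y hy).symm)
    -- The charts of the piece are supported by `Z`, so `x` and `y` choose the same atom there.
    exact tensorπ_map_congr _ (hZT j hj x y hxy) _ _
  have h4 : ∀ (z : Order.Ideal X) (hz : p ∈ upperBounds (X.norm '' (z : Set X))),
      f ≫ Φ.map (evaluation hC hP A z hz) = g ≫ Φ.map (l ≫ evaluation hC hP A z hz) :=
    fun z hz => by
      rw [← hg, Φ.map_comp, Category.assoc]
  rw [h4, h4, h1]

end NormCovering

end CLL

/-! ### Assembly of the lifting -/

theorem lemmaL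
    {𝒜 : Type u₁} [Category.{v₁} 𝒜] {ℬ : Type u₂} [Category.{v₂} ℬ]
    {𝒮 : Type u₃} [Category.{v₃} 𝒮]
    (lam mu : Cardinal.{w}) (hlam : ℵ₀ ≤ lam) (hmu : ℵ₀ ≤ mu)
    (Λ : CLL.LarderData 𝒜 ℬ 𝒮) (B : ℬ) (hΛ : Λ.IsLarderAt lam mu B)
    {P : Type w} [PartialOrder P]
    (X : CLL.NormCovering P) (XX : Set X.SharpIdeal)
    (hX : CLL.NormCovering.IsLifter lam X XX)
    (A : P ⥤ 𝒜) (hA : ∀ p, ¬ IsMax p → Λ.smallA (A.obj p))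
    (χ : Λ.Ψ.obj B ⟶ Λ.Φ.obj (CLL.condensate hΛ.closA hΛ.prodA X.scaled A))
    (hχ : Λ.double χ)
    (hcase :
      (mu = ℵ₀ ∧ ∀ x ∈ CLL.NormCovering.nonMaximal XX,
        {y | y ∈ CLL.NormCovering.nonMaximal XX ∧ y ≤ x}.Finite) ∨
      (mu = lam.ord.cof ∧ (CLL.NormCovering.nonMaximal XX).IsWF) ∨
      (mu = lam.ord.cof ∧ Λ.IsStrong mu)) :
    ∃ (Bd : P ⥤ ℬ) (χd : Bd ⋙ Λ.Ψ ⟶ A ⋙ Λ.Φ),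
      (∀ p, Λ.double (χd.app p)) ∧
      (∀ p, ¬ IsMax p → Λ.smallB (Bd.obj p)) ∧
      (∀ p, IsMax p → Bd.obj p = B) ∧
      (Λ.IsProjectable → ∃ Bd' : P ⥤ ℬ,
        Nonempty (Bd' ⋙ Λ.Ψ ≅ A ⋙ Λ.Φ) ∧
        ∃ τ : Bd ⟶ Bd', ∀ p, Epi (τ.app p)) := by
  classical
  open CLL CLL.NormCovering in
  let ρ : ∀ (x : Order.Ideal X) {p : P}, p ∈ upperBounds (X.norm '' (x : Set X)) →
      (Λ.Ψ.obj B ⟶ Λ.Φ.obj (A.obj p)) := fun x p hp =>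
    χ ≫ Λ.Φ.map (evaluation hΛ.closA hΛ.prodA A x hp)
  have hρ : ∀ (x : Order.Ideal X) {p : P} (hp : IsGreatest (X.norm '' (x : Set X)) p),
      Λ.double (ρ x hp.2) := fun x p hp =>
    Λ.isSubcategory.comp_mem _ _ hχ
      (hΛ.proj _ (isExtendedProjection_evaluation hΛ.closA hΛ.prodA A hp))
  obtain ⟨b⟩ := hΛ.exists_buttress hmu hX hcase (fun x => A.obj x.1.norm)
    (fun x => hA _ x.2.2) (fun x => ρ x.1.1 x.1.isGreatest_norm.2)
    (fun x => hρ x.1.1 x.1.isGreatest_norm)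
  choose Z hZ hZρ using fun x => hX.exists_support hlam hΛ.closA hΛ.prodA hΛ.cont A
    (hΛ.pres _ (b.small x)) (Λ.Ψ.map (b.leg x) ≫ χ)
  obtain ⟨σ, hσX, hσn, hσ⟩ := hX.free
    (fun x => if h : x ∈ nonMaximal XX then Z ⟨x, h⟩ else ∅) (fun x hx => by
      rw [dif_pos hx]
      exact hZ _)
  have hσm : ∀ p, ¬ IsMax p → σ p ∈ nonMaximal XX := fun p hp =>
    ⟨hσX p, by rwa [hσn]⟩
  have hσg : ∀ p, IsGreatest (X.norm '' ((σ p).1 : Set X)) p := fun p => by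
    have := (σ p).isGreatest_norm
    rwa [hσn] at this
  -- Maximal elements go to the added top, where `extendTop` takes the value `B`; the others go to
  -- the index of their object in the buttress.
  let t : P → WithTop {x // x ∈ nonMaximal XX} := fun p =>
    if h : IsMax p then ⊤ else ((⟨σ p, hσm p h⟩ : {x // x ∈ nonMaximal XX}) : WithTop _)
  have ht_max : ∀ p, IsMax p → t p = ⊤ := fun p hp => dif_pos hp
  have ht : ∀ p (hp : ¬ IsMax p),
      t p = ((⟨σ p, hσm p hp⟩ : {x // x ∈ nonMaximal XX}) : WithTop _) := fun p hp => dif_neg hp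
  have ht_mono : Monotone t := fun p q h => by
    by_cases hq : IsMax q
    · rw [ht_max q hq]
      exact le_top
    · have hp : ¬ IsMax p := fun hp => hq (hp.mono h)
      rw [ht p hp, ht q hq]
      exact WithTop.coe_le_coe.2 (σ.monotone h)
  let F := extendTop b.diag b.leg b.w
  let γ : ∀ s, F.obj s ⟶ B := extendTopLeg b.diag b.leg b.w
  have hγ : ∀ {s s' : WithTop {x // x ∈ nonMaximal XX}} (h : s ⟶ s'), F.map h ≫ γ s' = γ s :=
    fun h => (F.map_comp _ _).symm
  have hdouble : ∀ p, Λ.double (Λ.Ψ.map (γ (t p)) ≫ ρ (σ p).1 (hσg p).2) := by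
    intro p
    by_cases hp : IsMax p
    · rw [ht_max p hp]
      change Λ.double (Λ.Ψ.map (𝟙 B) ≫ _)
      rw [Λ.Ψ.map_id, Category.id_comp]
      exact hρ _ (hσg p)
    · rw [ht p hp]
      -- The buttress is stated with `(σ p).norm`, equal to `p` only propositionally; generalizing
      -- the target index `q` allows the substitution.
      have h1 : ∀ (q : P) (_ : q = (σ p).norm)
          (hq' : q ∈ upperBounds (X.norm '' ((σ p).1 : Set X))),
          Λ.double (Λ.Ψ.map (b.leg ⟨σ p, hσm p hp⟩) ≫ ρ (σ p).1 hq') := by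
        rintro q rfl hq'
        exact b.double ⟨σ p, hσm p hp⟩
      exact h1 p (hσn p).symm _
  have hcompat : ∀ {p q : P} (h : p ≤ q), Λ.Ψ.map (γ (t p)) ≫ ρ (σ q).1 (hσg q).2 =
      Λ.Ψ.map (γ (t p)) ≫ ρ (σ p).1 (hσg p).2 ≫ Λ.Φ.map (A.map (homOfLE h)) := by
    intro p q h
    have hpq : q ∈ upperBounds (X.norm '' ((σ p).1 : Set X)) := fun r hr =>
      ((hσg p).2 hr).trans h
    have h1 : ρ (σ p).1 (hσg p).2 ≫ Λ.Φ.map (A.map (homOfLE h)) = ρ (σ p).1 hpq := by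
      rw [Category.assoc, ← Λ.Φ.map_comp, evaluation_map]
    rw [h1]
    rcases h.eq_or_lt with rfl | hlt
    · rfl
    · have hp : ¬ IsMax p := hlt.not_isMax
      rw [ht p hp]
      -- Freeness of `σ` gives the agreement of `σ p` and `σ q` on `Z (σ p)`: one inclusion is the
      -- lifter property, the other is monotonicity of `σ`.
      have h2 := hZρ ⟨σ p, hσm p hp⟩ (σ q).1 (σ p).1 q (hσg q).2 hpq fun u hu => by
        refine ⟨fun huq => hσ p q hlt ⟨?_, huq⟩, fun hup => σ.monotone h hup⟩
        rw [dif_pos (hσm p hp)]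
        exact hu
      rw [Category.assoc, Category.assoc] at h2
      exact h2
  let Bd : P ⥤ ℬ := ht_mono.functor ⋙ F
  let χd : Bd ⋙ Λ.Ψ ⟶ A ⋙ Λ.Φ :=
    { app := fun p => Λ.Ψ.map (γ (t p)) ≫ ρ (σ p).1 (hσg p).2
      naturality := fun p q h => by
        change Λ.Ψ.map (F.map (homOfLE (ht_mono (leOfHom h)))) ≫ Λ.Ψ.map (γ (t q)) ≫ _ =
          (Λ.Ψ.map (γ (t p)) ≫ _) ≫ Λ.Φ.map (A.map h)
        rw [← Category.assoc, ← Λ.Ψ.map_comp, hγ, Category.assoc]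
        exact hcompat (leOfHom h) }
  refine ⟨Bd, χd, hdouble, fun p hp => ?_, fun p hp => ?_, fun hproj =>
    hproj.exists_lifting χd hdouble⟩
  · change Λ.smallB (F.obj (t p))
    rw [ht p hp]
    exact b.small _
  · change F.obj (t p) = B
    rw [ht_max p hp]
    rfl
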